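/- For every dimension $d\ge 1$ let $f=f_d$ be the standard Gaussian distribution on $\mathbb R^d$ and let $A=A_d\subset\mathbb R^d$ be a measurable set; write $p_f(A)=\mathbb P_f(X\in A)$ and let $f|_A$ be $f$ conditioned on $A$. A sequence $g=g_d$ of (possibly random) probability distributions on $\mathbb R^d$ is called \emph{efficient in high dimension for $A$} if, with $\ell=f/g$ the likelihood ratio, for every sequence of integers $n_p=n_p(d)\to\infty$, as $d\to\infty$, $$\mathbb E\left(\frac{\max_{i\le n_p}\ell(Y_i)}{\sum_{i\le n_p}\ell(Y_i)}\,\Big|\,g\right)\Rightarrow 0\quad\text{and}\quad \mathbb E\left(\left|\frac{1}{p_f(A)\,n_p}\sum_{i=1}^{n_p}\ell(Y_i)\mathbf 1_A(Y_i)-1\right|\,\Big|\,g\right)\Rightarrow 0,$$ where, given $g$, the $Y_i$ are i.i.d. with law $g$, and $\Rightarrow$ denotes convergence in distribution. Assume $\inf_d p_f(A)>0$, and let $\mu_A=\mathbb E_{f|_A}(X)$ and $\Sigma_A=\mathbb E_{f|_A}(XX^\top)-\mu_A\mu_A^\top$ be the mean and covariance matrix of $f|_A$. Then $g_A=N(\mu_A,\Sigma_A)$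 is efficient in high dimension for $A$. If moreover $n_g=n_g(d)$ is a sequence of integers with $n_g/d^2\to\infty$ and, for each $d$, $Y_{A,1},\dots,Y_{A,n_g}$ are i.i.d. with law $f|_A$, then $\hat g_A=N(\hat\mu_A,\hat\Sigma_A)$ with $$\hat\mu_A=\frac1{n_g}\sum_{k=1}^{n_g}Y_{A,k},\qquad \hat\Sigma_A=\frac1{n_g}\sum_{k=1}^{n_g}Y_{A,k}Y_{A,k}^\top-\hat\mu_A\hat\mu_A^\top$$ is also efficient in high dimension for $A$. -/

import Mathlib

open MeasureTheory ProbabilityTheory Filter Topology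

noncomputable section

namespace HighDimIS

/-- The Euclidean space `ℝ^d`. -/
abbrev Euc (d : ℕ+) : Type := EuclideanSpace ℝ (Fin (d : ℕ))

/-- The standard Gaussian distribution on `ℝ^d`. -/
abbrev stdN (d : ℕ+) : Measure (Euc d) := stdGaussian (Euc d)

/-- The likelihood ratio `ℓ = f / g` of two distributions: the density of `f` with respect to `g`,
which is the quotient of their Lebesgue densities when these are positive. -/
def likelihoodRatio {d : ℕ+} (f g : Measure (Euc d)) (x : Euc d) : ℝ :=
  (f.rnDeriv g x).toReal

/-- The expected weight-degeneracy ratio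
`E (max_{i ≤ n} ℓ(Y_i) / ∑_{i ≤ n} ℓ(Y_i))` with `Y_1, …, Y_n` i.i.d. of law `g`. -/
def weightRatio {d : ℕ+} (f g : Measure (Euc d)) (n : ℕ) : ℝ :=
  ∫ y : Fin n → Euc d,
    (⨆ i, likelihoodRatio f g (y i)) / ∑ i, likelihoodRatio f g (y i)
      ∂(Measure.pi fun _ : Fin n => g)

/-- The importance sampling estimator `(1/n) ∑_{i ≤ n} ℓ(y_i) 1_A(y_i)` of `p_f(A)`. -/
def isEstimator {d : ℕ+} (f g : Measure (Euc d)) (A : Set (Euc d)) (n : ℕ)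
    (y : Fin n → Euc d) : ℝ :=
  (1 / (n : ℝ)) * ∑ i, likelihoodRatio f g (y i) * A.indicator (fun _ => (1 : ℝ)) (y i)

/-- The relative `L¹` error `E |p̂_f(A) / p_f(A) - 1|` of the importance sampling estimator, with
`Y_1, …, Y_n` i.i.d. of law `g`. -/
def isError {d : ℕ+} (f g : Measure (Euc d)) (A : Set (Euc d)) (n : ℕ) : ℝ :=
  ∫ y : Fin n → Euc d, |isEstimator f g A n y / f.real A - 1| ∂(Measure.pi fun _ : Fin n => g)

/-- Convergence in distribution to the constant `0` of real random variables indexed by the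
dimension and defined on possibly different probability spaces. -/
def TendstoZeroInLaw {Ω : ℕ+ → Type*} [∀ d, MeasurableSpace (Ω d)]
    (P : ∀ d, Measure (Ω d)) [∀ d, IsProbabilityMeasure (P d)] (X : ∀ d, Ω d → ℝ) : Prop :=
  TendstoInDistribution X atTop (fun _ : Unit => (0 : ℝ)) P (Measure.dirac ())

/-- High-dimensional efficiency for `A` of a sequence of random auxiliary distributions
`g d ω`. The conditional expectations given `g` are the integrals with `g d ω` frozen. -/
def EfficientInHighDim {Ω : ℕ+ → Type*} [∀ d, MeasurableSpace (Ω d)]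
    (P : ∀ d, Measure (Ω d)) [∀ d, IsProbabilityMeasure (P d)]
    (f : ∀ d, Measure (Euc d)) (A : ∀ d, Set (Euc d)) (g : ∀ d, Ω d → Measure (Euc d)) : Prop :=
  ∀ n : ℕ+ → ℕ, Tendsto n atTop atTop →
    TendstoZeroInLaw P (fun d ω => weightRatio (f d) (g d ω) (n d)) ∧
    TendstoZeroInLaw P (fun d ω => isError (f d) (g d ω) (A d) (n d))

/-- High-dimensional efficiency for `A` of a sequence of deterministic auxiliary distributions:
the case of a one-point probability space. -/
def DetEfficientInHighDim (f : ∀ d, Measure (Euc d)) (A : ∀ d, Set (Euc d))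
    (g : ∀ d, Measure (Euc d)) : Prop :=
  EfficientInHighDim (Ω := fun _ => Unit) (fun _ => Measure.dirac ()) f A (fun d _ => g d)

/-- The mean `μ_A` of the conditioned distribution `f|_A`, with `f` standard Gaussian. -/
def condMean {d : ℕ+} (A : Set (Euc d)) : Euc d :=
  ∫ x, x ∂(cond (stdN d) A)

/-- The covariance matrix `Σ_A = E (X Xᵀ) - μ_A μ_Aᵀ` of `f|_A`, with `f` standard Gaussian. -/
def condCov {d : ℕ+} (A : Set (Euc d)) : Matrix (Fin (d : ℕ)) (Fin (d : ℕ)) ℝ :=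
  Matrix.of fun i j => (∫ x, x i * x j ∂(cond (stdN d) A)) - condMean A i * condMean A j

/-- The Gaussian distribution `g_A = N(μ_A, Σ_A)`. -/
def gaussA {d : ℕ+} (A : Set (Euc d)) : Measure (Euc d) :=
  multivariateGaussian (condMean A) (condCov A)

/-- The empirical mean `μ̂ = (1/n) ∑_k y_k`. -/
def empMean {d : ℕ+} {n : ℕ} (y : Fin n → Euc d) : Euc d :=
  (1 / (n : ℝ)) • ∑ k, y k

/-- The empirical covariance matrix `Σ̂ = (1/n) ∑_k y_k y_kᵀ - μ̂ μ̂ᵀ`. -/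
def empCov {d : ℕ+} {n : ℕ} (y : Fin n → Euc d) : Matrix (Fin (d : ℕ)) (Fin (d : ℕ)) ℝ :=
  Matrix.of fun i j => (1 / (n : ℝ)) * (∑ k, y k i * y k j) - empMean y i * empMean y j

/-- The Gaussian distribution `ĝ = N(μ̂, Σ̂)` estimated from the sample `y`. -/
def empGauss {d : ℕ+} {n : ℕ} (y : Fin n → Euc d) : Measure (Euc d) :=
  multivariateGaussian (empMean y) (empCov y)

end HighDimIS

end

/-!
If `KL(f ‖ g)` is bounded, then so is `log (f / g)` in `f`-probability, and truncating the
likelihood ratio at a high level bounds both efficiency criteria in terms of the sample size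
and the relative entropy alone, whatever the dimension. It therefore suffices to bound
`KL(f ‖ N(μ, Σ))` uniformly in `d`. Since `log (f / N(μ_A, Σ_A))` is a quadratic polynomial, its
mean under `f|_A` depends on the first two moments only, and Jensen's inequality gives
`tr Σ_A - d - log det Σ_A + ‖μ_A‖ ^ 2 ≤ -2 log p_f(A)`. This confines the spectrum of `Σ_A` away
from `0` and bounds `‖Σ_A - I‖` in Frobenius norm, so that the relative entropy stays bounded in
a Frobenius neighbourhood of `(μ_A, Σ_A)` of dimension-free radius. The empirical moments enter
that neighbourhood because their mean square error is of order `d ^ 2 / n_g`.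
-/

noncomputable section

namespace HighDimIS

section SampleMean

variable {α : Type*} {n : ℕ}

/-- The average `(1/n) ∑ i, u (y i)` of a function `u` over a sample `y`. -/
def sampleMean (u : α → ℝ) (y : Fin n → α) : ℝ := (1 / (n : ℝ)) * ∑ i, u (y i)

lemma sampleMean_sub (u v : α → ℝ) (y : Fin n → α) :
    sampleMean (fun x => u x - v x) y = sampleMean u y - sampleMean v y := by
  simp only [sampleMean, Finset.sum_sub_distrib, mul_sub]

lemma abs_sampleMean_le (u : α → ℝ) (y : Fin n → α) :
    |sampleMean u y| ≤ sampleMean (fun x => |u x|) y := by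
  rw [sampleMean, abs_mul, abs_of_nonneg (by positivity)]
  exact mul_le_mul_of_nonneg_left (Finset.abs_sum_le_sum_abs _ _) (by positivity)

variable [MeasurableSpace α] {g : Measure α} [IsProbabilityMeasure g]

lemma integrable_sampleMean {u : α → ℝ} (hu : Integrable u g) :
    Integrable (sampleMean u) (Measure.pi fun _ : Fin n => g) :=
  (integrable_finsetSum _ fun _ _ =>
    integrable_comp_eval (μ := fun _ : Fin n => g) hu).const_mul _

lemma integral_sampleMean (hn : n ≠ 0) {u : α → ℝ} (hu : Integrable u g) :
    ∫ y, sampleMean u y ∂(Measure.pi fun _ : Fin n => g) = ∫ x, u x ∂g := by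
  have hcoord (i : Fin n) : ∫ y : Fin n → α, u (y i) ∂(Measure.pi fun _ => g) = ∫ x, u x ∂g :=
    integral_comp_eval (μ := fun _ : Fin n => g) hu.1
  simp only [sampleMean]
  rw [integral_const_mul, integral_finsetSum _ fun _ _ =>
    integrable_comp_eval (μ := fun _ : Fin n => g) hu]
  simp only [hcoord, Finset.sum_const, Finset.card_univ, Fintype.card_fin, nsmul_eq_mul]
  field_simp

lemma memLp_sampleMean {v : α → ℝ} (hv : MemLp v 2 g) :
    MemLp (sampleMean v) 2 (Measure.pi fun _ : Fin n => g) :=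
  (memLp_finsetSum _ fun i _ =>
    hv.comp_measurePreserving (measurePreserving_eval (fun _ : Fin n => g) i)).const_mul _

lemma variance_sampleMean {v : α → ℝ} (hv : MemLp v 2 g) :
    Var[sampleMean v; Measure.pi fun _ : Fin n => g] = Var[v; g] / n := by
  have hsum : (fun y : Fin n → α => ∑ i, v (y i)) = ∑ i, fun y => v (y i) := by
    ext y; simp only [Finset.sum_apply]
  unfold sampleMean
  rw [variance_const_mul, hsum,
    variance_sum_pi (μ := fun _ : Fin n => g) (X := fun _ => v) fun _ => hv]
  simp only [Finset.sum_const, Finset.card_univ, Fintype.card_fin, nsmul_eq_mul]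
  rcases eq_or_ne n 0 with rfl | hn
  · simp
  · field_simp

lemma integral_abs_sub_integral_le_sqrt_variance {X : α → ℝ} (hX : MemLp X 2 g) :
    ∫ x, |X x - ∫ x', X x' ∂g| ∂g ≤ √Var[X; g] := by
  have hdev : MemLp (fun x => |X x - ∫ x', X x' ∂g|) 2 g := (hX.sub (memLp_const _)).abs
  have hvar := variance_nonneg (fun x => |X x - ∫ x', X x' ∂g|) g
  rw [variance_eq_sub hdev] at hvar
  simp only [Pi.pow_apply, sq_abs, ← variance_eq_integral hX.1.aemeasurable] at hvar
  exact Real.le_sqrt_of_sq_le (sub_nonneg.1 hvar)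

lemma variance_le_mul_integral {v : α → ℝ} {a : ℝ} (hv : Measurable v) (hv0 : ∀ x, 0 ≤ v x)
    (hva : ∀ x, v x ≤ a) : Var[v; g] ≤ a * ∫ x, v x ∂g := by
  have hv2 : MemLp v 2 g := MemLp.of_bound hv.aestronglyMeasurable a <| ae_of_all _ fun x => by
    rw [Real.norm_of_nonneg (hv0 x)]; exact hva x
  calc Var[v; g] ≤ ∫ x, v x ^ 2 ∂g := variance_le_expectation_sq hv2.1
    _ ≤ ∫ x, a * v x ∂g := integral_mono hv2.integrable_sq
        ((hv2.integrable one_le_two).const_mul a) fun x => by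
          simp only [sq]; exact mul_le_mul_of_nonneg_right (hva x) (hv0 x)
    _ = a * ∫ x, v x ∂g := integral_const_mul _ _

lemma integral_abs_sampleMean_sub_le_add (hn : n ≠ 0) {u v : α → ℝ} (hu : Integrable u g)
    (hv : Integrable v g) :
    ∫ y, |sampleMean u y - ∫ x, u x ∂g| ∂(Measure.pi fun _ : Fin n => g) ≤
      ∫ y, |sampleMean v y - ∫ x, v x ∂g| ∂(Measure.pi fun _ : Fin n => g) +
        2 * ∫ x, |u x - v x| ∂g := by
  have huv : Integrable (fun x => |u x - v x|) g := (hu.sub hv).abs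
  have hdev {w : α → ℝ} (hw : Integrable w g) : Integrable
      (fun y => |sampleMean w y - ∫ x, w x ∂g|) (Measure.pi fun _ : Fin n => g) :=
    ((integrable_sampleMean hw).sub (integrable_const _)).abs
  have hpointwise (y : Fin n → α) : |sampleMean u y - ∫ x, u x ∂g| ≤
      |sampleMean v y - ∫ x, v x ∂g| + sampleMean (fun x => |u x - v x|) y +
        ∫ x, |u x - v x| ∂g := by
    have hmean : |sampleMean u y - sampleMean v y| ≤ sampleMean (fun x => |u x - v x|) y :=
      sampleMean_sub u v y ▸ abs_sampleMean_le _ y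
    have hint : |∫ x, v x ∂g - ∫ x, u x ∂g| ≤ ∫ x, |u x - v x| ∂g := by
      rw [abs_sub_comm, ← integral_sub hu hv]
      exact abs_integral_le_integral_abs
    calc |sampleMean u y - ∫ x, u x ∂g|
        = |(sampleMean v y - ∫ x, v x ∂g) + (sampleMean u y - sampleMean v y) +
            (∫ x, v x ∂g - ∫ x, u x ∂g)| := by ring_nf
      _ ≤ _ := (abs_add_three _ _ _).trans (by gcongr)
  calc _ ≤ _ := integral_mono (hdev hu)
        (((hdev hv).add (integrable_sampleMean huv)).add (integrable_const _)) hpointwise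
    _ = _ := by
      rw [integral_add' ((hdev hv).add (integrable_sampleMean huv)) (integrable_const _),
        integral_add' (hdev hv) (integrable_sampleMean huv), integral_sampleMean hn huv]
      simp only [integral_const, probReal_univ, one_smul]
      ring

/-- The part of `u` below `a` is controlled by its variance, the part above by its mean. -/
lemma integral_abs_sampleMean_sub_le (hn : n ≠ 0) {u : α → ℝ} (hum : Measurable u)
    (hu0 : ∀ x, 0 ≤ u x) (hu : Integrable u g) {a : ℝ} (ha : 0 ≤ a) :
    ∫ y, |sampleMean u y - ∫ x, u x ∂g| ∂(Measure.pi fun _ : Fin n => g) ≤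
      2 * ∫ x in {x | a < u x}, u x ∂g + √((a * ∫ x, u x ∂g) / n) := by
  have htail : MeasurableSet {x | a < u x} := measurableSet_lt measurable_const hum
  set v := {x | a < u x}ᶜ.indicator u
  have hv0 (x) : 0 ≤ v x := Set.indicator_nonneg (fun x _ => hu0 x) x
  have hvu (x) : v x ≤ u x := Set.indicator_le_self' (fun x _ => hu0 x) x
  have hva (x) : v x ≤ a := Set.indicator_le' (fun x hx => not_lt.1 hx) (fun _ _ => ha) x
  have hvm : Measurable v := hum.indicator htail.compl
  have hvi : Integrable v g := hu.indicator htail.compl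
  have hv2 : MemLp v 2 g := MemLp.of_bound hvm.aestronglyMeasurable a <| ae_of_all _ fun x => by
    rw [Real.norm_of_nonneg (hv0 x)]; exact hva x
  have hdiff : ∫ x, |u x - v x| ∂g = ∫ x in {x | a < u x}, u x ∂g := by
    rw [← integral_indicator htail]
    refine integral_congr_ae (ae_of_all _ fun x => ?_)
    simp only
    rw [abs_of_nonneg (sub_nonneg.2 (hvu x))]
    simp only [v, Set.indicator_compl, Pi.sub_apply, sub_sub_cancel]
  have hmain : ∫ y, |sampleMean v y - ∫ x, v x ∂g| ∂(Measure.pi fun _ : Fin n => g) ≤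
      √((a * ∫ x, u x ∂g) / n) := by
    rw [← integral_sampleMean hn hvi]
    refine (integral_abs_sub_integral_le_sqrt_variance (memLp_sampleMean hv2)).trans ?_
    rw [variance_sampleMean hv2]
    gcongr
    exact (variance_le_mul_integral hvm hv0 hva).trans
      (mul_le_mul_of_nonneg_left (integral_mono hvi hu hvu) ha)
  have := integral_abs_sampleMean_sub_le_add hn hu hvi
  rw [hdiff] at this
  linarith

lemma iSup_div_sum_le {l w : Fin n → ℝ} (hn : n ≠ 0) (hl : ∀ i, 0 ≤ l i) (hw : ∀ i, 0 ≤ w i)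
    {a : ℝ} (ha : 0 ≤ a) (hlw : ∀ i, l i ≤ a + w i) :
    (⨆ i, l i) / ∑ i, l i ≤
      2 * a / n + 2 * (1 / n * ∑ i, w i) + 2 * |1 / (n : ℝ) * ∑ i, l i - 1| := by
  have : Nonempty (Fin n) := ⟨⟨0, Nat.pos_of_ne_zero hn⟩⟩
  have hn0 : (0 : ℝ) < n := by positivity
  have hW : 0 ≤ ∑ i, w i := Finset.sum_nonneg fun i _ => hw i
  have hsup_le_sum : ⨆ i, l i ≤ ∑ i, l i :=
    ciSup_le fun i => Finset.single_le_sum (fun i _ => hl i) (Finset.mem_univ i)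
  have hsup_le : ⨆ i, l i ≤ a + ∑ i, w i := ciSup_le fun i => (hlw i).trans <| by
    gcongr
    exact Finset.single_le_sum (fun i _ => hw i) (Finset.mem_univ i)
  rcases le_or_gt ((n : ℝ) / 2) (∑ i, l i) with hlarge | hsmall
  · calc (⨆ i, l i) / ∑ i, l i ≤ (a + ∑ i, w i) / (n / 2) := by gcongr
      _ = 2 * a / n + 2 * (1 / n * ∑ i, w i) := by field_simp
      _ ≤ _ := le_add_of_nonneg_right (by positivity)
  · have hmean : 1 / (n : ℝ) * ∑ i, l i < 1 / 2 := by
      rw [one_div, inv_mul_lt_iff₀ hn0]; linarith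
    have hratio : (⨆ i, l i) / ∑ i, l i ≤ 1 :=
      div_le_one_of_le₀ hsup_le_sum (Finset.sum_nonneg fun i _ => hl i)
    have habs := neg_abs_le (1 / (n : ℝ) * ∑ i, l i - 1)
    have : 0 ≤ 2 * a / n + 2 * (1 / n * ∑ i, w i) := by positivity
    linarith

lemma integral_iSup_div_sum_le (hn : n ≠ 0) {l : α → ℝ} (hlm : Measurable l)
    (hl0 : ∀ x, 0 ≤ l x) (hl : Integrable l g) (hl1 : ∫ x, l x ∂g = 1) {a : ℝ} (ha : 0 ≤ a) :
    ∫ y, (⨆ i, l (y i)) / ∑ i, l (y i) ∂(Measure.pi fun _ : Fin n => g) ≤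
      2 * a / n + 6 * ∫ x in {x | a < l x}, l x ∂g + 2 * √(a / n) := by
  have htail : MeasurableSet {x | a < l x} := measurableSet_lt measurable_const hlm
  set w := {x | a < l x}.indicator l with hw
  have hw0 (x) : 0 ≤ w x := Set.indicator_nonneg (fun x _ => hl0 x) x
  have hlw (x) : l x ≤ a + w x := by
    by_cases hx : a < l x
    · simp [hw, hx, ha]
    · simpa [hw, hx] using not_lt.1 hx
  have hwi : Integrable w g := hl.indicator htail
  have hmean : Integrable (fun y => 2 * a / n + 2 * sampleMean w y)
      (Measure.pi fun _ : Fin n => g) :=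
    (integrable_const _).add ((integrable_sampleMean hwi).const_mul 2)
  have hdev : Integrable (fun y => 2 * |sampleMean l y - 1|) (Measure.pi fun _ : Fin n => g) :=
    ((integrable_sampleMean hl).sub (integrable_const _)).abs.const_mul 2
  have hlln := integral_abs_sampleMean_sub_le hn hlm hl0 hl ha
  rw [hl1, mul_one] at hlln
  calc ∫ y, (⨆ i, l (y i)) / ∑ i, l (y i) ∂(Measure.pi fun _ : Fin n => g)
      ≤ ∫ y, (2 * a / n + 2 * sampleMean w y + 2 * |sampleMean l y - 1|)
          ∂(Measure.pi fun _ : Fin n => g) :=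
        integral_mono_of_nonneg (ae_of_all _ fun y => div_nonneg
          (Real.iSup_nonneg fun i => hl0 _) (Finset.sum_nonneg fun i _ => hl0 _))
          (hmean.add hdev) (ae_of_all _ fun y =>
            iSup_div_sum_le hn (fun i => hl0 (y i)) (fun i => hw0 (y i)) ha fun i => hlw (y i))
    _ = 2 * a / n + 2 * ∫ x in {x | a < l x}, l x ∂g +
          2 * ∫ y, |sampleMean l y - 1| ∂(Measure.pi fun _ : Fin n => g) := by
        rw [integral_add hmean hdev, integral_add (integrable_const _)
          ((integrable_sampleMean hwi).const_mul 2), integral_const_mul, integral_const_mul,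
          integral_sampleMean hn hwi, hw, integral_indicator htail]
        simp only [integral_const, probReal_univ, one_smul]
    _ ≤ _ := by linarith

end SampleMean

section RelativeEntropy

open InformationTheory
open scoped NNReal

variable {α : Type*} [MeasurableSpace α] {f g : Measure α} [IsProbabilityMeasure f]
  [IsProbabilityMeasure g]

lemma toReal_klDiv_eq_integral_llr (h : klDiv f g ≠ ⊤) :
    (klDiv f g).toReal = ∫ x, llr f g x ∂f :=
  toReal_klDiv_of_measure_eq (klDiv_ne_top_iff.1 h).1 (by simp only [measure_univ])

/-- Markov's inequality, applied to `llr f g + exp (-llr f g)`, which is nonnegative and dominates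
`llr f g`. -/
lemma setIntegral_rnDeriv_gt_exp_le (h : klDiv f g ≠ ⊤) {t : ℝ} (ht : 0 < t) :
    ∫ x in {x | Real.exp t < (f.rnDeriv g x).toReal}, (f.rnDeriv g x).toReal ∂g ≤
      ((klDiv f g).toReal + 1) / t := by
  obtain ⟨hac, hllr⟩ := klDiv_ne_top_iff.1 h
  have hexp_ae := exp_neg_llr hac
  have hexp : Integrable (fun x => Real.exp (-llr f g x)) f :=
    Measure.integrable_toReal_rnDeriv.congr hexp_ae.symm
  have hexp_le : ∫ x, Real.exp (-llr f g x) ∂f ≤ 1 := by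
    rw [integral_congr_ae hexp_ae, Measure.integral_toReal_rnDeriv', probReal_univ]
    exact sub_le_self _ measureReal_nonneg
  have hmarkov := mul_meas_ge_le_integral_of_nonneg (μ := f)
    (f := fun x => llr f g x + Real.exp (-llr f g x))
    (ae_of_all _ fun x => by
      simp only [Pi.zero_apply]; linarith [Real.add_one_le_exp (-llr f g x)]) (hllr.add hexp) t
  rw [integral_add hllr hexp, ← toReal_klDiv_eq_integral_llr h] at hmarkov
  have hsubset : {x | Real.exp t < (f.rnDeriv g x).toReal} ⊆
      {x | t ≤ llr f g x + Real.exp (-llr f g x)} := fun x hx =>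
    ((Real.lt_log_iff_exp_lt ((Real.exp_pos t).trans hx)).2 hx).le.trans
      (le_add_of_nonneg_right (Real.exp_pos _).le)
  rw [Measure.setIntegral_toReal_rnDeriv hac, le_div_iff₀ ht, mul_comm]
  exact (mul_le_mul_of_nonneg_left (measureReal_mono hsubset) ht.le).trans
    (hmarkov.trans (by gcongr))

end RelativeEntropy

section ImportanceSampling

open InformationTheory
open scoped NNReal

variable {d : ℕ+} {f g : Measure (Euc d)}

lemma weightRatio_nonneg (f g : Measure (Euc d)) (n : ℕ) : 0 ≤ weightRatio f g n :=
  integral_nonneg fun _ => div_nonneg (Real.iSup_nonneg fun _ => ENNReal.toReal_nonneg)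
    (Finset.sum_nonneg fun _ _ => ENNReal.toReal_nonneg)

lemma isError_nonneg (f g : Measure (Euc d)) (A : Set (Euc d)) (n : ℕ) : 0 ≤ isError f g A n :=
  integral_nonneg fun _ => abs_nonneg _

lemma measurable_likelihoodRatio (f g : Measure (Euc d)) : Measurable (likelihoodRatio f g) :=
  (Measure.measurable_rnDeriv f g).ennreal_toReal

lemma likelihoodRatio_nonneg (f g : Measure (Euc d)) (x : Euc d) : 0 ≤ likelihoodRatio f g x :=
  ENNReal.toReal_nonneg

lemma isEstimator_eq_sampleMean (A : Set (Euc d)) {n : ℕ} (y : Fin n → Euc d) :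
    isEstimator f g A n y = sampleMean (A.indicator (likelihoodRatio f g)) y := by
  simp only [isEstimator, sampleMean, ← Set.indicator_mul_right, mul_one]

lemma integrable_likelihoodRatio (f g : Measure (Euc d)) [IsFiniteMeasure f] :
    Integrable (likelihoodRatio f g) g :=
  Measure.integrable_toReal_rnDeriv

variable [IsProbabilityMeasure f] [IsProbabilityMeasure g] {n : ℕ}

lemma weightRatio_le (h : klDiv f g ≠ ⊤) (hn : n ≠ 0) {t : ℝ} (ht : 0 < t) :
    weightRatio f g n ≤ 6 * (((klDiv f g).toReal + 1) / t) +
      (2 * Real.exp t / n + 2 * √(Real.exp t / n)) := by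
  have hac := (klDiv_ne_top_iff.1 h).1
  have hmean : ∫ x, likelihoodRatio f g x ∂g = 1 :=
    (Measure.integral_toReal_rnDeriv hac).trans probReal_univ
  have hratio := integral_iSup_div_sum_le hn (measurable_likelihoodRatio f g)
    (likelihoodRatio_nonneg f g) (integrable_likelihoodRatio f g) hmean (Real.exp_pos t).le
  have htail := setIntegral_rnDeriv_gt_exp_le h ht
  simp only [likelihoodRatio] at hratio
  simp only [weightRatio, likelihoodRatio]
  linarith

lemma isError_le (h : klDiv f g ≠ ⊤) (hn : n ≠ 0) {A : Set (Euc d)} (hA : MeasurableSet A)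
    (hpA : 0 < f.real A) {t : ℝ} (ht : 0 < t) :
    isError f g A n ≤
      (2 * (((klDiv f g).toReal + 1) / t) + √(Real.exp t / n)) / f.real A := by
  have hac := (klDiv_ne_top_iff.1 h).1
  have hl0 := likelihoodRatio_nonneg f g
  have hli := integrable_likelihoodRatio f g
  have hmean : ∫ x, A.indicator (likelihoodRatio f g) x ∂g = f.real A := by
    rw [integral_indicator hA]
    exact Measure.setIntegral_toReal_rnDeriv hac A
  have htail : ∫ x in {x | Real.exp t < A.indicator (likelihoodRatio f g) x},
      A.indicator (likelihoodRatio f g) x ∂g ≤ ((klDiv f g).toReal + 1) / t := by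
    have hle := Set.indicator_le_self' (s := A) fun x _ => hl0 x
    refine le_trans ?_ (setIntegral_rnDeriv_gt_exp_le h ht)
    calc _ ≤ ∫ x in {x | Real.exp t < A.indicator (likelihoodRatio f g) x},
          likelihoodRatio f g x ∂g := integral_mono (hli.indicator hA).integrableOn
            hli.integrableOn hle
      _ ≤ ∫ x in {x | Real.exp t < likelihoodRatio f g x}, likelihoodRatio f g x ∂g :=
        setIntegral_mono_set hli.integrableOn (ae_of_all _ hl0)
          (Eventually.of_forall fun x (hx : _ < _) => hx.trans_le (hle x))
  have herror : isError f g A n = (∫ y, |sampleMean (A.indicator (likelihoodRatio f g)) y -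
      f.real A| ∂(Measure.pi fun _ : Fin n => g)) / f.real A := by
    rw [isError, ← integral_div]
    refine integral_congr_ae (ae_of_all _ fun y => ?_)
    simp only
    rw [isEstimator_eq_sampleMean, div_sub_one hpA.ne', abs_div, abs_of_pos hpA]
  have hlln := integral_abs_sampleMean_sub_le hn ((measurable_likelihoodRatio f g).indicator hA)
    (Set.indicator_nonneg fun x _ => hl0 x) (hli.indicator hA) (Real.exp_pos t).le
  rw [hmean] at hlln
  rw [herror]
  gcongr
  refine hlln.trans (add_le_add (by linarith) (Real.sqrt_le_sqrt ?_))
  gcongr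
  exact mul_le_of_le_one_right (Real.exp_pos t).le measureReal_le_one

lemma exists_forall_weightRatio_le (K : ℝ≥0) {ε : ℝ} (hε : 0 < ε) :
    ∃ N : ℕ, ∀ (d : ℕ+) (f g : Measure (Euc d)) [IsProbabilityMeasure f]
      [IsProbabilityMeasure g], klDiv f g ≤ K → ∀ n ≥ N, weightRatio f g n ≤ ε := by
  set t : ℝ := 12 * (K + 1) / ε with ht_def
  have ht : 0 < t := by positivity
  have hlim : Tendsto (fun n : ℕ => 2 * Real.exp t / n + 2 * √(Real.exp t / n)) atTop (𝓝 0) := by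
    simpa using (tendsto_const_div_atTop_nhds_zero_nat (2 * Real.exp t)).add
      ((tendsto_const_div_atTop_nhds_zero_nat (Real.exp t)).sqrt.const_mul 2)
  obtain ⟨N, hN⟩ := eventually_atTop.1
    ((hlim.eventually_le_const (half_pos hε)).and (eventually_ne_atTop 0))
  refine ⟨N, fun d f g _ _ hK n hn => ?_⟩
  obtain ⟨hsmall, hn0⟩ := hN n hn
  have hKreal : (klDiv f g).toReal ≤ K := ENNReal.toReal_le_coe_of_le_coe hK
  calc weightRatio f g n ≤ 6 * (((klDiv f g).toReal + 1) / t) +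
        (2 * Real.exp t / n + 2 * √(Real.exp t / n)) :=
      weightRatio_le (ne_top_of_le_ne_top ENNReal.coe_ne_top hK) hn0 ht
    _ ≤ 6 * ((K + 1) / t) + ε / 2 := by gcongr
    _ = ε := by rw [ht_def]; field_simp; norm_num

lemma exists_forall_isError_le (K : ℝ≥0) {p ε : ℝ} (hp : 0 < p) (hε : 0 < ε) :
    ∃ N : ℕ, ∀ (d : ℕ+) (f g : Measure (Euc d)) [IsProbabilityMeasure f]
      [IsProbabilityMeasure g] (A : Set (Euc d)), klDiv f g ≤ K → MeasurableSet A →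
      p ≤ f.real A → ∀ n ≥ N, isError f g A n ≤ ε := by
  set t : ℝ := 4 * (K + 1) / (p * ε) with ht_def
  have ht : 0 < t := by positivity
  have hlim : Tendsto (fun n : ℕ => √(Real.exp t / n) / p) atTop (𝓝 0) := by
    simpa using (tendsto_const_div_atTop_nhds_zero_nat (Real.exp t)).sqrt.div_const p
  obtain ⟨N, hN⟩ := eventually_atTop.1
    ((hlim.eventually_le_const (half_pos hε)).and (eventually_ne_atTop 0))
  refine ⟨N, fun d f g _ _ A hK hA hpA n hn => ?_⟩
  obtain ⟨hsmall, hn0⟩ := hN n hn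
  have hKreal : (klDiv f g).toReal ≤ K := ENNReal.toReal_le_coe_of_le_coe hK
  calc isError f g A n
      ≤ (2 * (((klDiv f g).toReal + 1) / t) + √(Real.exp t / n)) / f.real A :=
        isError_le (ne_top_of_le_ne_top ENNReal.coe_ne_top hK) hn0 hA (hp.trans_le hpA) ht
    _ ≤ (2 * ((K + 1) / t) + √(Real.exp t / n)) / p := by gcongr
    _ ≤ 2 * ((K + 1) / t) / p + ε / 2 := by rw [add_div]; gcongr
    _ = ε := by rw [ht_def]; field_simp; norm_num

end ImportanceSampling

section GaussianDensity

variable {E : Type*} [NormedAddCommGroup E] [InnerProductSpace ℝ E]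

variable (E) in
/-- The normalising constant `(2π)^(-dim E / 2)` of the standard Gaussian density. -/
def gaussianNormConst : ℝ := ((2 * Real.pi) ^ (Module.finrank ℝ E / 2 : ℝ))⁻¹

/-- The Lebesgue density of the standard Gaussian distribution. -/
def stdGaussianPDF (x : E) : ℝ := gaussianNormConst E * Real.exp (-‖x‖ ^ 2 / 2)

lemma stdGaussianPDF_nonneg (x : E) : 0 ≤ stdGaussianPDF x := by
  unfold stdGaussianPDF gaussianNormConst; positivity

lemma stdGaussianPDF_mul_exp (x y : E) :
    stdGaussianPDF x * Real.exp ((‖x‖ ^ 2 - ‖y‖ ^ 2) / 2) = stdGaussianPDF y := by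
  rw [stdGaussianPDF, stdGaussianPDF, mul_assoc, ← Real.exp_add]
  ring_nf

variable (E) in
lemma gaussianNormConst_mul_cpow :
    (gaussianNormConst E : ℂ) * (Real.pi / (1 / 2) : ℂ) ^ (Module.finrank ℝ E / 2 : ℂ) = 1 := by
  have hbase : (Real.pi / (1 / 2) : ℂ) = ((2 * Real.pi : ℝ) : ℂ) := by push_cast; ring
  have hexponent : (Module.finrank ℝ E / 2 : ℂ) = ((Module.finrank ℝ E / 2 : ℝ) : ℂ) := by
    push_cast; rfl
  rw [hbase, hexponent, ← Complex.ofReal_cpow (by positivity), ← Complex.ofReal_mul,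
    gaussianNormConst, inv_mul_cancel₀ (by positivity), Complex.ofReal_one]

variable [MeasurableSpace E] [BorelSpace E]

lemma measurable_stdGaussianPDF : Measurable (stdGaussianPDF : E → ℝ) := by
  unfold stdGaussianPDF; fun_prop

variable [FiniteDimensional ℝ E]

lemma integrable_stdGaussianPDF : Integrable (stdGaussianPDF : E → ℝ) := by
  have h := GaussianFourier.integrable_cexp_neg_mul_sq_norm_add (V := E) (b := (1 / 2 : ℂ))
    (by norm_num) 0 0
  refine (h.norm.congr (ae_of_all _ fun x => ?_)).const_mul _
  simp only [Complex.norm_exp]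
  congr 1
  simp [← Complex.ofReal_pow]
  ring

variable (E) in
lemma stdGaussian_eq_withDensity :
    stdGaussian E = volume.withDensity fun x : E => ENNReal.ofReal (stdGaussianPDF x) := by
  have : IsFiniteMeasure (volume.withDensity fun x : E => ENNReal.ofReal (stdGaussianPDF x)) :=
    isFiniteMeasure_withDensity_ofReal integrable_stdGaussianPDF.2
  refine Measure.ext_of_charFun (funext fun t => ?_)
  rw [charFun_stdGaussian, charFun_apply, integral_withDensity_eq_integral_toReal_smul
    measurable_stdGaussianPDF.ennreal_ofReal (by simp)]
  have hintegrand (x : E) : (ENNReal.ofReal (stdGaussianPDF x)).toReal •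
      Complex.exp (inner ℝ x t * Complex.I) = (gaussianNormConst E : ℂ) *
        Complex.exp (-(1 / 2) * ‖x‖ ^ 2 + Complex.I * inner ℝ t x) := by
    rw [ENNReal.toReal_ofReal (stdGaussianPDF_nonneg x), Complex.real_smul, Complex.exp_add,
      real_inner_comm t x, stdGaussianPDF]
    push_cast
    ring_nf
  simp_rw [hintegrand]
  rw [integral_const_mul, GaussianFourier.integral_cexp_neg_mul_sq_norm_add (by norm_num),
    ← mul_assoc, gaussianNormConst_mul_cpow, one_mul, Complex.I_sq]
  ring_nf

lemma map_add_equiv_volume (μ : E) (L : E ≃L[ℝ] E) :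
    (volume : Measure E).map (fun z => μ + L z) =
      ENNReal.ofReal |(L.symm : E →L[ℝ] E).det| • volume := by
  have hlin : (volume : Measure E).map L = ENNReal.ofReal |(L.symm : E →L[ℝ] E).det| • volume := by
    rw [ContinuousLinearEquiv.det_coe_symm]
    exact Measure.map_linearMap_addHaar_eq_smul_addHaar volume
      (LinearEquiv.isUnit_det' L.toLinearEquiv).ne_zero
  have hcomp : (fun z => μ + L z) = (fun x => μ + x) ∘ L := rfl
  rw [hcomp, ← Measure.map_map (by fun_prop) (by fun_prop), hlin, Measure.map_smul,
    map_add_left_eq_self]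

lemma stdGaussian_map_add_equiv (μ : E) (L : E ≃L[ℝ] E) :
    (stdGaussian E).map (fun z => μ + L z) = (stdGaussian E).withDensity fun x =>
      ENNReal.ofReal (|(L.symm : E →L[ℝ] E).det| *
        Real.exp ((‖x‖ ^ 2 - ‖L.symm (x - μ)‖ ^ 2) / 2)) := by
  have hpdf : Measurable fun x : E => ENNReal.ofReal (stdGaussianPDF x) :=
    measurable_stdGaussianPDF.ennreal_ofReal
  refine Measure.ext_of_lintegral _ fun φ hφ => ?_
  rw [lintegral_map hφ (by fun_prop),
    lintegral_withDensity_eq_lintegral_mul _ (by fun_prop) hφ, stdGaussian_eq_withDensity E,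
    lintegral_withDensity_eq_lintegral_mul _ hpdf (by fun_prop),
    lintegral_withDensity_eq_lintegral_mul _ hpdf (by fun_prop)]
  have hsubst (z : E) : ENNReal.ofReal (stdGaussianPDF z) * φ (μ + L z) =
      (fun x => ENNReal.ofReal (stdGaussianPDF (L.symm (x - μ))) * φ x) (μ + L z) := by
    simp only [add_sub_cancel_left, ContinuousLinearEquiv.symm_apply_apply]
  simp only [Pi.mul_apply, hsubst]
  rw [← lintegral_map (f := fun x => ENNReal.ofReal (stdGaussianPDF (L.symm (x - μ))) * φ x)
    ((hpdf.comp (by fun_prop)).mul hφ) (by fun_prop), map_add_equiv_volume,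
    lintegral_smul_measure, smul_eq_mul, ← lintegral_const_mul' _ _ ENNReal.ofReal_ne_top]
  refine lintegral_congr fun x => ?_
  rw [← mul_assoc, ← mul_assoc, ← ENNReal.ofReal_mul (abs_nonneg _),
    ← ENNReal.ofReal_mul (stdGaussianPDF_nonneg x), mul_left_comm, stdGaussianPDF_mul_exp]

end GaussianDensity

section LogLikelihoodRatio

open Matrix InformationTheory
open scoped MatrixOrder

lemma klDiv_withDensity_exp_neg {α : Type*} [MeasurableSpace α] {f : Measure α}
    [IsProbabilityMeasure f] {h : α → ℝ} (hh : Measurable h) (hint : Integrable h f)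
    [IsProbabilityMeasure (f.withDensity fun x => ENNReal.ofReal (Real.exp (-h x)))] :
    klDiv f (f.withDensity fun x => ENNReal.ofReal (Real.exp (-h x))) =
      ENNReal.ofReal (∫ x, h x ∂f) := by
  have hdens : Measurable fun x => ENNReal.ofReal (Real.exp (-h x)) := by fun_prop
  have hac : f ≪ f.withDensity fun x => ENNReal.ofReal (Real.exp (-h x)) :=
    withDensity_absolutelyContinuous' hdens.aemeasurable
      (ae_of_all _ fun x => (ENNReal.ofReal_pos.2 (Real.exp_pos _)).ne')
  have hllr : llr f (f.withDensity fun x => ENNReal.ofReal (Real.exp (-h x))) =ᵐ[f] h := by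
    filter_upwards [neg_llr hac, Measure.rnDeriv_withDensity f hdens] with x hneg hrn
    rw [← neg_neg (llr f _ x), ← Pi.neg_apply (llr f _), hneg, llr_def]
    simp only [hrn, ENNReal.toReal_ofReal (Real.exp_pos _).le, Real.log_exp, neg_neg]
  rw [klDiv_of_ac_of_integrable hac (hint.congr hllr.symm), integral_congr_ae hllr, probReal_univ,
    probReal_univ, add_sub_cancel_right]

variable {ι : Type*} [Fintype ι]

/-- The mean of a distribution on Euclidean space. -/
def mean (Q : Measure (EuclideanSpace ℝ ι)) : EuclideanSpace ℝ ι := ∫ x, x ∂Q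

/-- The covariance matrix of a distribution on Euclidean space. -/
def covMatrix (Q : Measure (EuclideanSpace ℝ ι)) : Matrix ι ι ℝ :=
  Matrix.of fun i j => cov[fun x => x i, fun x => x j; Q]

variable {Q : Measure (EuclideanSpace ℝ ι)}

lemma memLp_coord {p : ENNReal} (hQ : MemLp id p Q) (i : ι) : MemLp (fun x => x i) p Q :=
  (EuclideanSpace.proj (𝕜 := ℝ) i).comp_memLp' hQ

lemma mean_apply (hQ : Integrable id Q) (i : ι) : mean Q i = ∫ x, x i ∂Q :=
  ((EuclideanSpace.proj (𝕜 := ℝ) i).integral_comp_comm hQ).symm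

lemma integral_sub_mul_sub [IsProbabilityMeasure Q] (hQ : MemLp id 2 Q)
    (μ : EuclideanSpace ℝ ι) (i j : ι) :
    ∫ x, (x i - μ i) * (x j - μ j) ∂Q =
      covMatrix Q i j + (mean Q - μ) i * (mean Q - μ) j := by
  have hmemLp (k : ι) : MemLp (fun x => x k - μ k) 2 Q :=
    (memLp_coord hQ k).sub (memLp_const (μ k))
  have hint (k : ι) : Integrable (fun x => x k) Q := (memLp_coord hQ k).integrable one_le_two
  have hmean (k : ι) : ∫ x, (x k - μ k) ∂Q = (mean Q - μ) k := by
    rw [integral_sub (hint k) (integrable_const _), ← mean_apply (hQ.integrable one_le_two)]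
    simp only [integral_const, probReal_univ, one_smul, PiLp.sub_apply]
  have hcov := covariance_eq_sub (hmemLp i) (hmemLp j)
  rw [covariance_sub_const_left (hint i), covariance_sub_const_right (hint j), hmean, hmean] at hcov
  exact sub_eq_iff_eq_add.1 hcov.symm

lemma integrable_dotProduct_mulVec [IsFiniteMeasure Q] (hQ : MemLp id 2 Q)
    (μ : EuclideanSpace ℝ ι) (B : Matrix ι ι ℝ) :
    Integrable (fun x => (x - μ).ofLp ⬝ᵥ B *ᵥ (x - μ).ofLp) Q := by
  have hcoord (i : ι) : MemLp (fun x : EuclideanSpace ℝ ι => x i - μ i) 2 Q :=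
    (memLp_coord hQ i).sub (memLp_const (μ i))
  simp only [dotProduct, mulVec, Finset.mul_sum]
  refine integrable_finsetSum _ fun i _ => integrable_finsetSum _ fun j _ => ?_
  refine (((hcoord i).integrable_mul (hcoord j)).const_mul (B i j)).congr (ae_of_all _ fun x => ?_)
  simp only [PiLp.sub_apply, Pi.mul_apply]
  ring

lemma integral_dotProduct_mulVec [IsProbabilityMeasure Q] (hQ : MemLp id 2 Q)
    (μ : EuclideanSpace ℝ ι) (B : Matrix ι ι ℝ) :
    ∫ x, (x - μ).ofLp ⬝ᵥ B *ᵥ (x - μ).ofLp ∂Q =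
      (B * covMatrix Q).trace + (mean Q - μ).ofLp ⬝ᵥ B *ᵥ (mean Q - μ).ofLp := by
  have hint (i j : ι) : Integrable
      (fun x : EuclideanSpace ℝ ι => B i j * ((x i - μ i) * (x j - μ j))) Q :=
    (MemLp.integrable_mul ((memLp_coord hQ i).sub (memLp_const (μ i)))
      ((memLp_coord hQ j).sub (memLp_const (μ j)))).const_mul _
  have hexpand (v : EuclideanSpace ℝ ι) :
      v.ofLp ⬝ᵥ B *ᵥ v.ofLp = ∑ i, ∑ j, B i j * (v i * v j) := by
    simp only [dotProduct, mulVec, Finset.mul_sum, mul_left_comm]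
  simp only [hexpand, PiLp.sub_apply]
  rw [integral_finsetSum _ fun i _ => integrable_finsetSum _ fun j _ => hint i j]
  simp_rw [integral_finsetSum _ fun j _ => hint _ j, integral_const_mul,
    integral_sub_mul_sub hQ, mul_add, Finset.sum_add_distrib]
  congr 1
  simp only [trace, diag_apply, mul_apply]
  refine Finset.sum_congr rfl fun i _ => Finset.sum_congr rfl fun j _ => ?_
  rw [covMatrix, of_apply, of_apply, covariance_comm]

variable [DecidableEq ι] {S : Matrix ι ι ℝ}

/-- The logarithm of the likelihood ratio of the standard Gaussian to `N(μ, S)`. -/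
def logLR (μ : EuclideanSpace ℝ ι) (S : Matrix ι ι ℝ) (x : EuclideanSpace ℝ ι) : ℝ :=
  (Real.log S.det + (x - μ).ofLp ⬝ᵥ S⁻¹ *ᵥ (x - μ).ofLp - ‖x‖ ^ 2) / 2

lemma measurable_logLR (μ : EuclideanSpace ℝ ι) (S : Matrix ι ι ℝ) : Measurable (logLR μ S) := by
  have hquad : Continuous fun x : EuclideanSpace ℝ ι =>
      (x - μ).ofLp ⬝ᵥ S⁻¹ *ᵥ (x - μ).ofLp := by fun_prop
  exact (((continuous_const.add hquad).sub (by fun_prop)).div_const 2).measurable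

lemma integrable_logLR [IsFiniteMeasure Q] (hQ : MemLp id 2 Q) (μ : EuclideanSpace ℝ ι)
    (S : Matrix ι ι ℝ) : Integrable (logLR μ S) Q :=
  (((integrable_const _).add (integrable_dotProduct_mulVec hQ μ S⁻¹)).sub
    (hQ.integrable_norm_pow two_ne_zero)).div_const 2

lemma integral_logLR [IsProbabilityMeasure Q] (hQ : MemLp id 2 Q) (μ : EuclideanSpace ℝ ι)
    (S : Matrix ι ι ℝ) :
    ∫ x, logLR μ S x ∂Q = (Real.log S.det + (S⁻¹ * covMatrix Q).trace +
      (mean Q - μ).ofLp ⬝ᵥ S⁻¹ *ᵥ (mean Q - μ).ofLp - (covMatrix Q).trace - ‖mean Q‖ ^ 2) / 2 := by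
  have hnorm (v : EuclideanSpace ℝ ι) : ‖v‖ ^ 2 =
      (v - 0).ofLp ⬝ᵥ (1 : Matrix ι ι ℝ) *ᵥ (v - 0).ofLp := by
    rw [sub_zero, one_mulVec, EuclideanSpace.real_norm_sq_eq]
    simp only [dotProduct, sq]
  have hquad := integrable_dotProduct_mulVec hQ μ S⁻¹
  have hadd : Integrable (fun x => Real.log S.det + (x - μ).ofLp ⬝ᵥ S⁻¹ *ᵥ (x - μ).ofLp) Q :=
    (integrable_const _).add hquad
  have hsq : Integrable (fun x => ‖x‖ ^ 2) Q := hQ.integrable_norm_pow two_ne_zero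
  have hsplit : ∫ x, logLR μ S x ∂Q =
      (Real.log S.det + ∫ x, (x - μ).ofLp ⬝ᵥ S⁻¹ *ᵥ (x - μ).ofLp ∂Q - ∫ x, ‖x‖ ^ 2 ∂Q) / 2 := by
    simp only [logLR]
    rw [integral_div, integral_sub hadd hsq, integral_add (integrable_const _) hquad,
      integral_const, probReal_univ, one_smul]
  rw [hsplit, integral_dotProduct_mulVec hQ]
  simp only [hnorm, integral_dotProduct_mulVec hQ, one_mul]
  ring

lemma covMatrix_stdGaussian : covMatrix (stdGaussian (EuclideanSpace ℝ ι)) = 1 := by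
  ext i j
  rw [← multivariateGaussian_zero_one]
  exact covariance_eval_multivariateGaussian PosSemidef.one i j

lemma integral_logLR_stdGaussian (μ : EuclideanSpace ℝ ι) (S : Matrix ι ι ℝ) :
    ∫ x, logLR μ S x ∂(stdGaussian (EuclideanSpace ℝ ι)) =
      (Real.log S.det + S⁻¹.trace + μ.ofLp ⬝ᵥ S⁻¹ *ᵥ μ.ofLp - Fintype.card ι) / 2 := by
  rw [integral_logLR IsGaussian.memLp_two_id, covMatrix_stdGaussian, mean, integral_id_stdGaussian,
    mul_one, trace_one, zero_sub, WithLp.ofLp_neg, mulVec_neg, neg_dotProduct_neg, norm_zero]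
  ring

lemma det_toEuclideanCLM (R : Matrix ι ι ℝ) : (toEuclideanCLM (𝕜 := ℝ) R).det = R.det := by
  rw [ContinuousLinearMap.det, coe_toEuclideanCLM_eq_toEuclideanLin,
    toEuclideanLin_eq_toLin_orthonormal, LinearMap.det_toLin]

lemma norm_toEuclideanCLM_sqrt_sq (hS : S.PosSemidef) (v : EuclideanSpace ℝ ι) :
    ‖toEuclideanCLM (𝕜 := ℝ) (CFC.sqrt S) v‖ ^ 2 = v.ofLp ⬝ᵥ S *ᵥ v.ofLp := by
  rw [← real_inner_self_eq_norm_sq, ← ContinuousLinearMap.adjoint_inner_right,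
    ← ContinuousLinearMap.star_eq_adjoint, ← map_star,
    ((CFC.sqrt_nonneg S).isSelfAdjoint).star_eq, ← mul_apply_eq_comp, ← map_mul,
    CFC.sqrt_mul_sqrt_self S hS.nonneg, inner_toEuclideanCLM]

lemma multivariateGaussian_eq_withDensity (hS : S.PosDef) (μ : EuclideanSpace ℝ ι) :
    multivariateGaussian μ S = (stdGaussian (EuclideanSpace ℝ ι)).withDensity fun x =>
      ENNReal.ofReal (Real.exp (-logLR μ S x)) := by
  have hunit : IsUnit (CFC.sqrt S).det := by
    rw [← isUnit_iff_isUnit_det]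
    exact hS.isStrictlyPositive.isUnit_cfcSqrt
  have hinv : (CFC.sqrt S)⁻¹ = CFC.sqrt S⁻¹ := hS.posSemidef.inv_sqrt
  let L : EuclideanSpace ℝ ι ≃L[ℝ] EuclideanSpace ℝ ι :=
    .equivOfInverse (toEuclideanCLM (𝕜 := ℝ) (CFC.sqrt S))
      (toEuclideanCLM (𝕜 := ℝ) (CFC.sqrt S⁻¹))
      (fun x => by
        rw [← hinv, ← mul_apply_eq_comp, ← map_mul, nonsing_inv_mul _ hunit, map_one,
          one_apply_eq_self])
      (fun x => by
        rw [← hinv, ← mul_apply_eq_comp, ← map_mul, mul_nonsing_inv _ hunit, map_one,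
          one_apply_eq_self])
  have hdet : |(L.symm : EuclideanSpace ℝ ι →L[ℝ] EuclideanSpace ℝ ι).det| =
      Real.exp (-Real.log S.det / 2) := by
    change |(toEuclideanCLM (𝕜 := ℝ) (CFC.sqrt S⁻¹)).det| = _
    rw [det_toEuclideanCLM, hS.inv.posSemidef.det_sqrt, RCLike.sqrt_of_nonneg hS.inv.det_pos.le,
      det_nonsing_inv, Ring.inverse_eq_inv', ← Real.log_inv, Real.exp_half,
      Real.exp_log (inv_pos.2 hS.det_pos)]
    exact abs_of_nonneg (Real.sqrt_nonneg _)
  refine (stdGaussian_map_add_equiv μ L).trans ?_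
  congr 1 with x
  rw [hdet, ← Real.exp_add, show ‖L.symm (x - μ)‖ ^ 2 = _ from norm_toEuclideanCLM_sqrt_sq
    hS.inv.posSemidef (x - μ), logLR]
  ring_nf

lemma klDiv_stdGaussian_multivariateGaussian (hS : S.PosDef) (μ : EuclideanSpace ℝ ι) :
    klDiv (stdGaussian (EuclideanSpace ℝ ι)) (multivariateGaussian μ S) = ENNReal.ofReal
      ((Real.log S.det + S⁻¹.trace + μ.ofLp ⬝ᵥ S⁻¹ *ᵥ μ.ofLp - Fintype.card ι) / 2) := by
  have hdens := multivariateGaussian_eq_withDensity hS μ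
  have : IsProbabilityMeasure ((stdGaussian (EuclideanSpace ℝ ι)).withDensity fun x =>
      ENNReal.ofReal (Real.exp (-logLR μ S x))) := hdens ▸ inferInstance
  rw [hdens, klDiv_withDensity_exp_neg (measurable_logLR μ S)
    (integrable_logLR IsGaussian.memLp_two_id μ S), integral_logLR_stdGaussian]

lemma integrable_exp_neg_logLR (hS : S.PosDef) (μ : EuclideanSpace ℝ ι) :
    Integrable (fun x => Real.exp (-logLR μ S x)) (stdGaussian (EuclideanSpace ℝ ι)) := by
  rw [← lintegral_ofReal_ne_top_iff_integrable
    (f := fun x => Real.exp (-logLR μ S x))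
    (measurable_logLR μ S).neg.exp.aestronglyMeasurable (ae_of_all _ fun x => (Real.exp_pos _).le),
    ← setLIntegral_univ, ← withDensity_apply _ .univ, ← multivariateGaussian_eq_withDensity hS]
  exact measure_ne_top _ _

lemma integral_exp_neg_logLR (hS : S.PosDef) (μ : EuclideanSpace ℝ ι) :
    ∫ x, Real.exp (-logLR μ S x) ∂stdGaussian (EuclideanSpace ℝ ι) = 1 := by
  rw [integral_eq_lintegral_of_nonneg_ae (ae_of_all _ fun x => (Real.exp_pos _).le)
    (integrable_exp_neg_logLR hS μ).1, ← setLIntegral_univ, ← withDensity_apply _ .univ,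
    ← multivariateGaussian_eq_withDensity hS, measure_univ, ENNReal.toReal_one]

end LogLikelihoodRatio

section SteinLoss

open Matrix InformationTheory
open scoped NNReal MatrixOrder Matrix.Norms.Frobenius

lemma posDef_of_smul_one_le {ι : Type*} [DecidableEq ι] {S : Matrix ι ι ℝ} {c : ℝ}
    (hc : 0 < c) (h : c • 1 ≤ S) : S.PosDef := by
  have hsum := (PosDef.one.smul hc).add_posSemidef (le_iff.1 h)
  rwa [add_sub_cancel] at hsum

variable {ι : Type*} [Fintype ι]

lemma frobenius_norm_sq {κ : Type*} [Fintype κ] (A : Matrix ι κ ℝ) :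
    ‖A‖ ^ 2 = ∑ i, ∑ j, A i j ^ 2 := by
  rw [frobenius_norm_def, ← Real.sqrt_eq_rpow, Real.sq_sqrt (by positivity)]
  simp only [Real.rpow_two, Real.norm_eq_abs, sq_abs]

lemma frobenius_norm_sq_eq_trace {κ : Type*} [Fintype κ] (A : Matrix ι κ ℝ) :
    ‖A‖ ^ 2 = (Aᵀ * A).trace := by
  rw [frobenius_norm_sq, Finset.sum_comm]
  simp only [trace, diag_apply, mul_apply, transpose_apply, sq]

lemma norm_sq_eq_dotProduct (v : EuclideanSpace ℝ ι) : ‖v‖ ^ 2 = v.ofLp ⬝ᵥ v.ofLp := by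
  rw [EuclideanSpace.real_norm_sq_eq]
  simp only [dotProduct, sq]

lemma abs_dotProduct_mulVec_le (B : Matrix ι ι ℝ) (v : ι → ℝ) :
    |v ⬝ᵥ B *ᵥ v| ≤ ‖B‖ * (v ⬝ᵥ v) := by
  have hvv : 0 ≤ v ⬝ᵥ v := Finset.sum_nonneg fun i _ => mul_self_nonneg _
  have hquad : v ⬝ᵥ B *ᵥ v = ∑ p : ι × ι, B p.1 p.2 * (v p.1 * v p.2) := by
    simp only [Fintype.sum_prod_type, dotProduct, mulVec, Finset.mul_sum, mul_left_comm]
  have hsq : (v ⬝ᵥ v) ^ 2 = ∑ p : ι × ι, (v p.1 * v p.2) ^ 2 := by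
    simp only [Fintype.sum_prod_type, dotProduct, sq, Finset.sum_mul_sum, mul_mul_mul_comm]
  refine abs_le_of_sq_le_sq ?_ (by positivity)
  rw [hquad, mul_pow, frobenius_norm_sq, hsq, ← Fintype.sum_prod_type']
  exact Finset.sum_mul_sq_le_sq_mul_sq _ _ _

variable [DecidableEq ι] {S : Matrix ι ι ℝ} {c B : ℝ}

lemma smul_one_le_iff (hS : S.IsHermitian) :
    c • 1 ≤ S ↔ ∀ v, c * (v ⬝ᵥ v) ≤ v ⬝ᵥ S *ᵥ v := by
  have hquad (v : ι → ℝ) :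
      star v ⬝ᵥ (S - c • 1) *ᵥ v = v ⬝ᵥ S *ᵥ v - c * (v ⬝ᵥ v) := by
    rw [star_trivial, sub_mulVec, smul_mulVec, one_mulVec, dotProduct_sub, dotProduct_smul,
      smul_eq_mul]
  have hherm : (S - c • 1).IsHermitian := hS.sub ((isHermitian_one).smul (star_trivial c))
  simp only [le_iff, posSemidef_iff_dotProduct_mulVec, hquad, sub_nonneg, hherm, true_and]

lemma trace_cfc (hS : S.IsHermitian) (φ : ℝ → ℝ) :
    (cfc φ S).trace = ∑ i, φ (hS.eigenvalues i) := by
  rw [hS.cfc_eq, IsHermitian.cfc, Unitary.conjStarAlgAut_apply, trace_mul_cycle,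
    Unitary.coe_star_mul_self, one_mul, trace_diagonal]
  rfl

lemma log_det_eq_sum_log_eigenvalues (hS : S.PosDef) :
    Real.log S.det = ∑ i, Real.log (hS.1.eigenvalues i) := by
  rw [hS.1.det_eq_prod_eigenvalues]
  exact Real.log_prod fun i _ => (hS.eigenvalues_pos i).ne'

/-- Stein's loss `tr S - d - log det S`, twice the relative entropy of `N(0, S)` with respect to the
standard Gaussian. It measures how far `S` is from the identity. -/
def steinLoss (S : Matrix ι ι ℝ) : ℝ := S.trace - Fintype.card ι - Real.log S.det

lemma steinLoss_eq_sum (hS : S.PosDef) :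
    steinLoss S = ∑ i, (hS.1.eigenvalues i - 1 - Real.log (hS.1.eigenvalues i)) := by
  rw [steinLoss, log_det_eq_sum_log_eigenvalues hS, hS.1.trace_eq_sum_eigenvalues]
  simp

lemma sub_one_sub_log_nonneg {x : ℝ} (hx : 0 < x) : 0 ≤ x - 1 - Real.log x := by
  linarith [Real.log_le_sub_one_of_pos hx]

lemma steinLoss_nonneg (hS : S.PosDef) : 0 ≤ steinLoss S := by
  rw [steinLoss_eq_sum hS]
  exact Finset.sum_nonneg fun i _ => sub_one_sub_log_nonneg (hS.eigenvalues_pos i)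

lemma eigenvalue_sub_one_sub_log_le (hS : S.PosDef) (i : ι) :
    hS.1.eigenvalues i - 1 - Real.log (hS.1.eigenvalues i) ≤ steinLoss S := by
  rw [steinLoss_eq_sum hS]
  exact Finset.single_le_sum
    (f := fun i => hS.1.eigenvalues i - 1 - Real.log (hS.1.eigenvalues i))
    (fun i _ => sub_one_sub_log_nonneg (hS.eigenvalues_pos i)) (Finset.mem_univ i)

lemma exp_smul_one_le_of_steinLoss_le (hS : S.PosDef) (h : steinLoss S ≤ B) :
    Real.exp (-1 - B) • 1 ≤ S := by
  rw [← Algebra.algebraMap_eq_smul_one]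
  refine (algebraMap_le_iff_le_spectrum (ha := hS.1.isSelfAdjoint)).2 fun x hx => ?_
  obtain ⟨i, rfl⟩ := hS.1.spectrum_real_eq_range_eigenvalues ▸ hx
  have hpos := hS.eigenvalues_pos i
  rw [← Real.le_log_iff_exp_le hpos]
  linarith [eigenvalue_sub_one_sub_log_le hS i]

/-- Both factors of `x - 1 = (√x - 1) (√x + 1)` are controlled by
`(√x - 1) ^ 2 ≤ x - 1 - log x`. -/
lemma sub_one_sq_le {x : ℝ} (hx : 0 < x) (h : x - 1 - Real.log x ≤ B) :
    (x - 1) ^ 2 ≤ (x - 1 - Real.log x) * (2 + √B) ^ 2 := by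
  have hsq := Real.sq_sqrt hx.le
  have hlog : Real.log x ≤ 2 * (√x - 1) := by
    have := Real.log_le_sub_one_of_pos (Real.sqrt_pos.2 hx)
    rw [Real.log_sqrt hx.le] at this
    linarith
  have hminus : (√x - 1) ^ 2 ≤ x - 1 - Real.log x := by nlinarith
  have hplus : √x + 1 ≤ 2 + √B := by linarith [Real.le_sqrt_of_sq_le (hminus.trans h)]
  calc (x - 1) ^ 2 = (√x - 1) ^ 2 * (√x + 1) ^ 2 := by rw [← mul_pow]; congr 1; nlinarith
    _ ≤ _ := by gcongr; exact sub_one_sub_log_nonneg hx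

lemma frobenius_norm_sub_one_sq_le_of_steinLoss_le (hS : S.PosDef) (h : steinLoss S ≤ B) :
    ‖S - 1‖ ^ 2 ≤ B * (2 + √B) ^ 2 := by
  have hcfc : (S - 1)ᵀ * (S - 1) = cfc (fun x : ℝ => (x - 1) ^ 2) S := by
    have hsa : IsSelfAdjoint S := hS.1.isSelfAdjoint
    have htranspose : (S - 1)ᵀ = S - 1 := hS.1.sub isHermitian_one
    rw [htranspose, ← sq, cfc_pow (fun x : ℝ => x - 1) 2 S,
      cfc_sub .., cfc_id' ℝ S, cfc_const_one ℝ S]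
  rw [frobenius_norm_sq_eq_trace, hcfc, trace_cfc hS.1]
  calc ∑ i, (hS.1.eigenvalues i - 1) ^ 2
      ≤ ∑ i, (hS.1.eigenvalues i - 1 - Real.log (hS.1.eigenvalues i)) * (2 + √B) ^ 2 :=
        Finset.sum_le_sum fun i _ => sub_one_sq_le (hS.eigenvalues_pos i)
          ((eigenvalue_sub_one_sub_log_le hS i).trans h)
    _ = steinLoss S * (2 + √B) ^ 2 := by rw [← Finset.sum_mul, steinLoss_eq_sum hS]
    _ ≤ B * (2 + √B) ^ 2 := by gcongr

lemma dotProduct_inv_mulVec_le (hc : 0 < c) (h : c • 1 ≤ S) (v : ι → ℝ) :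
    v ⬝ᵥ S⁻¹ *ᵥ v ≤ (v ⬝ᵥ v) / c := by
  have hS := posDef_of_smul_one_le hc h
  have hSu : S *ᵥ S⁻¹ *ᵥ v = v := by
    rw [mulVec_mulVec, mul_nonsing_inv _ (isUnit_iff_ne_zero.2 hS.det_pos.ne'), one_mulVec]
  have hlower := (smul_one_le_iff hS.1).1 h (S⁻¹ *ᵥ v)
  have hsq : 0 ≤ (v - c • S⁻¹ *ᵥ v) ⬝ᵥ (v - c • S⁻¹ *ᵥ v) :=
    Finset.sum_nonneg fun i _ => mul_self_nonneg _
  simp only [sub_dotProduct, dotProduct_sub, smul_dotProduct, dotProduct_smul, smul_eq_mul] at hsq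
  rw [hSu, dotProduct_comm _ v] at hlower
  rw [dotProduct_comm (S⁻¹ *ᵥ v) v] at hsq
  rw [le_div_iff₀ hc]
  nlinarith

lemma trace_inv_add_trace_le (hc : 0 < c) (h : c • 1 ≤ S) :
    S⁻¹.trace + S.trace ≤ 2 * Fintype.card ι + ‖S - 1‖ ^ 2 / c := by
  have hS := posDef_of_smul_one_le hc h
  have hunit : IsUnit S.det := isUnit_iff_ne_zero.2 hS.det_pos.ne'
  have hfactor : S⁻¹ + S - (1 + 1) = (S - 1)ᵀ * S⁻¹ * (S - 1) := by
    have htranspose : (S - 1)ᵀ = S - 1 := hS.1.sub isHermitian_one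
    rw [htranspose, sub_mul, one_mul, mul_nonsing_inv _ hunit, mul_sub, sub_mul,
      nonsing_inv_mul _ hunit]
    simp only [one_mul, mul_one]
    abel
  have htrace : ((S - 1)ᵀ * S⁻¹ * (S - 1)).trace ≤ ‖S - 1‖ ^ 2 / c := by
    rw [frobenius_norm_sq, Finset.sum_comm, Finset.sum_div, mul_assoc]
    refine Finset.sum_le_sum fun j _ => ?_
    have hcol : (S - 1).col j ⬝ᵥ (S - 1).col j = ∑ i, (S - 1) i j ^ 2 :=
      Finset.sum_congr rfl fun i _ => (sq ((S - 1) i j)).symm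
    exact hcol ▸ dotProduct_inv_mulVec_le hc h ((S - 1).col j)
  have heq := congrArg Matrix.trace hfactor
  simp only [trace_sub, trace_add, trace_one] at heq
  linarith

lemma klDiv_stdGaussian_multivariateGaussian_le (hc : 0 < c) (h : c • 1 ≤ S)
    (μ : EuclideanSpace ℝ ι) :
    klDiv (stdGaussian (EuclideanSpace ℝ ι)) (multivariateGaussian μ S) ≤
      ENNReal.ofReal ((‖S - 1‖ ^ 2 + ‖μ‖ ^ 2) / c) := by
  have hS := posDef_of_smul_one_le hc h
  rw [klDiv_stdGaussian_multivariateGaussian hS]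
  refine ENNReal.ofReal_le_ofReal ?_
  have hmean := dotProduct_inv_mulVec_le hc h μ.ofLp
  have hstein := steinLoss_nonneg hS
  have htrace := trace_inv_add_trace_le hc h
  have hnonneg : 0 ≤ (‖S - 1‖ ^ 2 + ‖μ‖ ^ 2) / c := by positivity
  rw [steinLoss] at hstein
  rw [← norm_sq_eq_dotProduct] at hmean
  rw [add_div] at hnonneg ⊢
  linarith

lemma smul_one_le_of_frobenius_norm_sub_le {S' : Matrix ι ι ℝ} {δ : ℝ} (hS' : S'.IsHermitian)
    (hS : S.IsHermitian) (h : c • 1 ≤ S) (hδ : ‖S' - S‖ ≤ δ) : (c - δ) • 1 ≤ S' := by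
  refine (smul_one_le_iff hS').2 fun v => ?_
  have hlower := (smul_one_le_iff hS).1 h v
  have hquad := (abs_le.1 (abs_dotProduct_mulVec_le (S' - S) v)).1
  have hvv : 0 ≤ v ⬝ᵥ v := Finset.sum_nonneg fun i _ => mul_self_nonneg _
  rw [sub_mulVec, dotProduct_sub] at hquad
  nlinarith [mul_le_mul_of_nonneg_right hδ hvv]

lemma exists_klDiv_le_of_norm_sub_le (B : ℝ) : ∃ δ > 0, ∃ K : ℝ≥0, ∀ {ι : Type*} [Fintype ι]
    [DecidableEq ι] {S S' : Matrix ι ι ℝ} {μ μ' : EuclideanSpace ℝ ι}, S.PosDef →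
    steinLoss S ≤ B → ‖μ‖ ^ 2 ≤ B → S'.IsHermitian → ‖S' - S‖ ≤ δ → ‖μ' - μ‖ ≤ δ →
      klDiv (stdGaussian (EuclideanSpace ℝ ι)) (multivariateGaussian μ' S') ≤ K := by
  set δ := Real.exp (-1 - B) / 2
  refine ⟨δ, by positivity, (((δ + √B * (2 + √B)) ^ 2 + (δ + √B) ^ 2) / δ).toNNReal,
    fun {ι _ _ S S' μ μ'} hS hB hμ hS' hSS' hμμ' => ?_⟩
  have hB0 : 0 ≤ B := (sq_nonneg _).trans hμ
  have hcov : ‖S - 1‖ ≤ √B * (2 + √B) := by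
    refine abs_le_of_sq_le_sq' ?_ (by positivity) |>.2
    rw [mul_pow, Real.sq_sqrt hB0]
    exact frobenius_norm_sub_one_sq_le_of_steinLoss_le hS hB
  have hmean : ‖μ‖ ≤ √B := Real.le_sqrt_of_sq_le hμ
  have hlower : δ • 1 ≤ S' := by
    have := smul_one_le_of_frobenius_norm_sub_le hS' hS.1 (exp_smul_one_le_of_steinLoss_le hS hB)
      hSS'
    rwa [sub_half] at this
  refine (klDiv_stdGaussian_multivariateGaussian_le (by positivity) hlower μ').trans
    (ENNReal.ofReal_le_ofReal ?_)
  gcongr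
  · exact (norm_sub_le_norm_sub_add_norm_sub S' S 1).trans (add_le_add hSS' hcov)
  · exact (norm_le_norm_sub_add μ' μ).trans (add_le_add hμμ' hmean)

end SteinLoss

section Conditioning

open Matrix

section General

variable {α : Type*} [MeasurableSpace α] {f : Measure α} {A : Set α}

lemma memLp_cond {E : Type*} [NormedAddCommGroup E] {h : α → E} {p : ENNReal} (hA : f A ≠ 0)
    (hh : MemLp h p f) : MemLp h p (cond f A) :=
  (hh.restrict A).smul_measure (ENNReal.inv_ne_top.2 hA)

lemma integrable_cond {h : α → ℝ} (hA : f A ≠ 0) (hh : Integrable h f) :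
    Integrable h (cond f A) :=
  memLp_one_iff_integrable.1 (memLp_cond hA (memLp_one_iff_integrable.2 hh))

lemma integral_cond_le {h : α → ℝ} (hh : Integrable h f) (h0 : ∀ x, 0 ≤ h x) :
    ∫ x, h x ∂(cond f A) ≤ (∫ x, h x ∂f) / f.real A := by
  rw [ProbabilityTheory.cond, integral_smul_measure, ENNReal.toReal_inv, smul_eq_mul,
    div_eq_inv_mul]
  exact mul_le_mul_of_nonneg_left (setIntegral_le_integral hh (ae_of_all _ h0))
    (inv_nonneg.2 measureReal_nonneg)

lemma integral_cond_le_log_sub_log [IsFiniteMeasure f] {h : α → ℝ} (hA : f A ≠ 0)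
    (hh : Integrable h f) (hexp : Integrable (fun x => Real.exp (h x)) f) :
    ∫ x, h x ∂(cond f A) ≤ Real.log (∫ x, Real.exp (h x) ∂f) - Real.log (f.real A) := by
  have := cond_isProbabilityMeasure hA
  have hpos : 0 < f.real A := ENNReal.toReal_pos hA (measure_ne_top _ _)
  have hjensen : Real.exp (∫ x, h x ∂(cond f A)) ≤ (∫ x, Real.exp (h x) ∂f) / f.real A :=
    (convexOn_exp.map_integral_le Real.continuous_exp.continuousOn isClosed_univ (by simp)
      (integrable_cond hA hh) (integrable_cond hA hexp)).trans
      (integral_cond_le hexp fun x => (Real.exp_pos _).le)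
  have hnum : 0 < ∫ x, Real.exp (h x) ∂f :=
    (div_pos_iff_of_pos_right hpos).1 ((Real.exp_pos _).trans_le hjensen)
  rw [← Real.log_div hnum.ne' hpos.ne']
  exact (Real.le_log_iff_exp_le (div_pos hnum hpos)).2 hjensen

end General

section Covariance

variable {ι : Type*} {Q : Measure (EuclideanSpace ℝ ι)}

lemma isHermitian_covMatrix (Q : Measure (EuclideanSpace ℝ ι)) : (covMatrix Q).IsHermitian := by
  ext i j
  exact covariance_comm _ _

variable [Fintype ι]

lemma dotProduct_covMatrix_mulVec [IsProbabilityMeasure Q] (hQ : MemLp id 2 Q) (v : ι → ℝ) :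
    v ⬝ᵥ covMatrix Q *ᵥ v = ∫ x, (v ⬝ᵥ (x - mean Q).ofLp) ^ 2 ∂Q := by
  have hrank (x : EuclideanSpace ℝ ι) : (v ⬝ᵥ (x - mean Q).ofLp) ^ 2 =
      (x - mean Q).ofLp ⬝ᵥ vecMulVec v v *ᵥ (x - mean Q).ofLp := by
    rw [vecMulVec_mulVec, dotProduct_smul, dotProduct_comm _ v]
    simp [sq]
  simp only [hrank, integral_dotProduct_mulVec hQ]
  rw [sub_self, vecMulVec_mul, trace_vecMulVec, WithLp.ofLp_zero, zero_dotProduct, add_zero,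
    dotProduct_mulVec, dotProduct_comm]

lemma volume_dotProduct_sub_eq_zero {v : ι → ℝ} (hv : v ≠ 0) (m : EuclideanSpace ℝ ι) :
    volume {x : EuclideanSpace ℝ ι | v ⬝ᵥ (x - m).ofLp = 0} = 0 := by
  let H : Submodule ℝ (EuclideanSpace ℝ ι) := (innerSL ℝ (WithLp.toLp 2 v)).ker
  have hset : {x : EuclideanSpace ℝ ι | v ⬝ᵥ (x - m).ofLp = 0} = (fun x => x + -m) ⁻¹' H := by
    ext x
    simp [H, PiLp.inner_apply, dotProduct, mul_comm, ← sub_eq_add_neg]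
  have hH : H ≠ ⊤ := fun h => hv <| by
    have hmem : WithLp.toLp 2 v ∈ H := h ▸ Submodule.mem_top
    simpa [H] using hmem
  rw [hset, measure_preimage_add_right, Measure.addHaar_submodule _ _ hH]

lemma posDef_covMatrix [IsProbabilityMeasure Q] (hQ : MemLp id 2 Q) (hac : Q ≪ volume) :
    (covMatrix Q).PosDef := by
  refine PosDef.of_dotProduct_mulVec_pos (isHermitian_covMatrix Q) fun v hv => ?_
  have hmemLp : MemLp (fun x : EuclideanSpace ℝ ι => v ⬝ᵥ (x - mean Q).ofLp) 2 Q :=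
    memLp_finsetSum _ fun i _ => ((memLp_coord hQ i).sub (memLp_const (mean Q i))).const_mul (v i)
  rw [star_trivial, dotProduct_covMatrix_mulVec hQ]
  refine (integral_nonneg fun x => sq_nonneg _).lt_of_ne' fun hzero => ?_
  rw [integral_eq_zero_iff_of_nonneg (fun x => sq_nonneg _) hmemLp.integrable_sq] at hzero
  have hnull := hac (volume_dotProduct_sub_eq_zero hv (mean Q))
  have hfalse : ∀ᵐ _ ∂Q, False := by
    filter_upwards [hzero, measure_eq_zero_iff_ae_notMem.1 hnull] with x hx hx'
    exact hx' (pow_eq_zero_iff two_ne_zero |>.1 hx)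
  exact hfalse.exists.choose_spec

end Covariance

section StandardGaussian

variable {ι : Type*} [Fintype ι] {A : Set (EuclideanSpace ℝ ι)}

lemma memLp_id_cond_stdGaussian (hA : stdGaussian (EuclideanSpace ℝ ι) A ≠ 0) :
    MemLp id 2 (cond (stdGaussian (EuclideanSpace ℝ ι)) A) :=
  memLp_cond hA IsGaussian.memLp_two_id

lemma posDef_covMatrix_cond (hA : stdGaussian (EuclideanSpace ℝ ι) A ≠ 0) :
    (covMatrix (cond (stdGaussian (EuclideanSpace ℝ ι)) A)).PosDef := by
  have := cond_isProbabilityMeasure hA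
  refine posDef_covMatrix (memLp_id_cond_stdGaussian hA) (cond_absolutelyContinuous.trans ?_)
  exact stdGaussian_eq_withDensity (EuclideanSpace ℝ ι) ▸ withDensity_absolutelyContinuous _ _

variable [DecidableEq ι]

lemma steinLoss_covMatrix_cond_add_le (hA : stdGaussian (EuclideanSpace ℝ ι) A ≠ 0) :
    steinLoss (covMatrix (cond (stdGaussian (EuclideanSpace ℝ ι)) A)) +
        ‖mean (cond (stdGaussian (EuclideanSpace ℝ ι)) A)‖ ^ 2 ≤
      -2 * Real.log ((stdGaussian (EuclideanSpace ℝ ι)).real A) := by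
  have := cond_isProbabilityMeasure hA
  have hS := posDef_covMatrix_cond hA
  set Q := cond (stdGaussian (EuclideanSpace ℝ ι)) A with hQ
  have hdv := integral_cond_le_log_sub_log hA
    (integrable_logLR IsGaussian.memLp_two_id (mean Q) (covMatrix Q)).neg
    (integrable_exp_neg_logLR hS (mean Q))
  simp only [Pi.neg_apply] at hdv
  rw [integral_exp_neg_logLR hS, ← hQ, integral_neg,
    integral_logLR (memLp_id_cond_stdGaussian hA),
    nonsing_inv_mul _ (isUnit_iff_ne_zero.2 hS.det_pos.ne'), sub_self, WithLp.ofLp_zero,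
    zero_dotProduct, trace_one, Real.log_one] at hdv
  rw [steinLoss]
  linarith

end StandardGaussian

end Conditioning

section FittedGaussian

open Matrix InformationTheory
open scoped NNReal Matrix.Norms.Frobenius

variable {d : ℕ+} {A : Set (Euc d)} {n : ℕ}

/-- The second moment matrix `E (X Xᵀ)` of a distribution on Euclidean space. -/
def secondMoment {ι : Type*} (Q : Measure (EuclideanSpace ℝ ι)) : Matrix ι ι ℝ :=
  Matrix.of fun i j => ∫ x, x i * x j ∂Q

/-- The second moment matrix `(1/n) ∑_k y_k y_kᵀ` of a sample. -/
def empSecondMoment {ι : Type*} (y : Fin n → EuclideanSpace ℝ ι) : Matrix ι ι ℝ :=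
  Matrix.of fun i j => sampleMean (fun x => x i * x j) y

lemma empMean_apply (y : Fin n → Euc d) (i : Fin d) :
    empMean y i = sampleMean (fun x => x i) y := by
  simp [empMean, sampleMean]

lemma frobenius_norm_vecMulVec {ι : Type*} [Fintype ι] (a b : EuclideanSpace ℝ ι) :
    ‖vecMulVec a.ofLp b.ofLp‖ = ‖a‖ * ‖b‖ := by
  refine (sq_eq_sq₀ (norm_nonneg _) (by positivity)).1 ?_
  rw [frobenius_norm_sq, mul_pow, EuclideanSpace.real_norm_sq_eq, EuclideanSpace.real_norm_sq_eq,
    Finset.sum_mul_sum]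
  simp only [vecMulVec_apply, mul_pow]

lemma condCov_eq_sub_vecMulVec (A : Set (Euc d)) :
    condCov A = secondMoment (cond (stdN d) A) - vecMulVec (condMean A).ofLp (condMean A).ofLp :=
  rfl

lemma empCov_eq_sub_vecMulVec (y : Fin n → Euc d) :
    empCov y = empSecondMoment y - vecMulVec (empMean y).ofLp (empMean y).ofLp :=
  rfl

lemma posSemidef_empCov (y : Fin n → Euc d) : (empCov y).PosSemidef := by
  let X : Matrix (Fin n) (Fin d) ℝ := Matrix.of fun k i => y k i - empMean y i
  have hcov : empCov y = (1 / (n : ℝ)) • (Xᴴ * X) := by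
    ext i j
    rcases eq_or_ne n 0 with rfl | hn
    · simp [empCov, empMean]
    have hsum (i : Fin d) : ∑ k, y k i = n * empMean y i := by
      rw [empMean_apply, sampleMean]
      field_simp
    simp only [empCov, X, of_apply, Matrix.smul_apply, mul_apply, conjTranspose_apply, star_trivial,
      smul_eq_mul, sub_mul, mul_sub, Finset.sum_sub_distrib, ← Finset.mul_sum, ← Finset.sum_mul,
      hsum, Finset.sum_const, Finset.card_univ, Fintype.card_fin, nsmul_eq_mul]
    field_simp
    ring
  rw [hcov]
  exact (posSemidef_conjTranspose_mul_self X).smul (by positivity)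

lemma condCov_eq_covMatrix (hA : stdN d A ≠ 0) : condCov A = covMatrix (cond (stdN d) A) := by
  have := cond_isProbabilityMeasure hA
  have hQ := memLp_id_cond_stdGaussian hA
  ext i j
  exact (covariance_eq_sub (memLp_coord hQ i) (memLp_coord hQ j)).trans
    (by rw [← mean_apply (hQ.integrable one_le_two), ← mean_apply (hQ.integrable one_le_two)]; rfl)
    |>.symm

lemma posDef_condCov (hA : stdN d A ≠ 0) : (condCov A).PosDef :=
  condCov_eq_covMatrix hA ▸ posDef_covMatrix_cond hA

lemma steinLoss_condCov_add_le (hA : stdN d A ≠ 0) :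
    steinLoss (condCov A) + ‖condMean A‖ ^ 2 ≤ -2 * Real.log ((stdN d).real A) :=
  condCov_eq_covMatrix hA ▸ steinLoss_covMatrix_cond_add_le hA

lemma norm_condMean_sq_le {p : ℝ} (hp : 0 < p) (hpA : p ≤ (stdN d).real A) :
    ‖condMean A‖ ^ 2 ≤ -2 * Real.log p := by
  have hA : stdN d A ≠ 0 := (measureReal_ne_zero_iff ..).1 (hp.trans_le hpA).ne'
  linarith [steinLoss_condCov_add_le hA, steinLoss_nonneg (posDef_condCov hA),
    Real.log_le_log hp hpA]

lemma exists_klDiv_multivariateGaussian_le {p : ℝ} (hp : 0 < p) :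
    ∃ δ > 0, ∃ K : ℝ≥0, ∀ (d : ℕ+) (A : Set (Euc d)), p ≤ (stdN d).real A →
      ∀ (μ : Euc d) (S : Matrix (Fin d) (Fin d) ℝ), S.IsHermitian → ‖S - condCov A‖ ≤ δ →
        ‖μ - condMean A‖ ≤ δ → klDiv (stdN d) (multivariateGaussian μ S) ≤ K := by
  obtain ⟨δ, hδ, K, hK⟩ := exists_klDiv_le_of_norm_sub_le (-2 * Real.log p)
  refine ⟨δ, hδ, K, fun d A hpA μ S hS hcov hmean => ?_⟩
  have hA : stdN d A ≠ 0 := (measureReal_ne_zero_iff ..).1 (hp.trans_le hpA).ne'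
  have hstein : steinLoss (condCov A) ≤ -2 * Real.log p := by
    linarith [steinLoss_condCov_add_le hA, sq_nonneg ‖condMean A‖, Real.log_le_log hp hpA]
  exact hK (posDef_condCov hA) hstein (norm_condMean_sq_le hp hpA) hS hcov hmean

lemma exists_klDiv_gaussA_le {p : ℝ} (hp : 0 < p) :
    ∃ K : ℝ≥0, ∀ (d : ℕ+) (A : Set (Euc d)), p ≤ (stdN d).real A →
      klDiv (stdN d) (gaussA A) ≤ K := by
  obtain ⟨δ, hδ, K, hK⟩ := exists_klDiv_multivariateGaussian_le hp
  refine ⟨K, fun d A hpA => hK d A hpA _ _ ?_ ?_ ?_⟩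
  · exact (posDef_condCov ((measureReal_ne_zero_iff ..).1 (hp.trans_le hpA).ne')).1
  · simpa only [sub_self, norm_zero] using hδ.le
  · simpa only [sub_self, norm_zero] using hδ.le

lemma norm_empCov_sub_condCov_le (A : Set (Euc d)) (y : Fin n → Euc d) :
    ‖empCov y - condCov A‖ ≤ ‖empSecondMoment y - secondMoment (cond (stdN d) A)‖ +
      ‖empMean y - condMean A‖ * (‖empMean y - condMean A‖ + 2 * ‖condMean A‖) := by
  have hrank : empCov y - condCov A = empSecondMoment y - secondMoment (cond (stdN d) A) -
      (vecMulVec (empMean y - condMean A).ofLp (empMean y).ofLp +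
        vecMulVec (condMean A).ofLp (empMean y - condMean A).ofLp) := by
    rw [empCov_eq_sub_vecMulVec, condCov_eq_sub_vecMulVec, WithLp.ofLp_sub, sub_vecMulVec,
      vecMulVec_sub]
    abel
  have hmean : ‖empMean y‖ ≤ ‖empMean y - condMean A‖ + ‖condMean A‖ := norm_le_norm_sub_add _ _
  calc ‖empCov y - condCov A‖
      ≤ ‖empSecondMoment y - secondMoment (cond (stdN d) A)‖ +
          (‖empMean y - condMean A‖ * ‖empMean y‖ + ‖condMean A‖ * ‖empMean y - condMean A‖) := by
        rw [hrank, ← frobenius_norm_vecMulVec, ← frobenius_norm_vecMulVec]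
        exact (norm_sub_le _ _).trans (add_le_add_right (norm_add_le _ _) _)
    _ ≤ _ := by nlinarith [norm_nonneg (empMean y - condMean A)]

lemma exists_klDiv_empGauss_le {p : ℝ} (hp : 0 < p) :
    ∃ δ > 0, ∃ K : ℝ≥0, ∀ (d : ℕ+) (A : Set (Euc d)), p ≤ (stdN d).real A →
      ∀ (n : ℕ) (y : Fin n → Euc d),
        ‖empSecondMoment y - secondMoment (cond (stdN d) A)‖ ^ 2 ≤ δ →
        ‖empMean y - condMean A‖ ^ 2 ≤ δ → klDiv (stdN d) (empGauss y) ≤ K := by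
  obtain ⟨η, hη, K, hK⟩ := exists_klDiv_multivariateGaussian_le hp
  set b := √(-2 * Real.log p)
  set δ := min 1 (η / (2 + 2 * b))
  have hδ0 : 0 < δ := lt_min one_pos (by positivity)
  have hδ1 : δ ≤ 1 := min_le_left _ _
  have hδη : δ * (2 + 2 * b) ≤ η := (le_div_iff₀ (by positivity)).1 (min_le_right _ _)
  have hb0 : 0 ≤ b := Real.sqrt_nonneg _
  refine ⟨δ ^ 2, by positivity, K, fun d A hpA n y hsecond hmean => ?_⟩
  rw [sq_le_sq₀ (norm_nonneg _) hδ0.le] at hsecond hmean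
  have hcond : ‖condMean A‖ ≤ b := Real.le_sqrt_of_sq_le (norm_condMean_sq_le hp hpA)
  refine hK d A hpA _ _ (posSemidef_empCov y).isHermitian ?_ (hmean.trans (by nlinarith))
  calc ‖empCov y - condCov A‖ ≤ δ + δ * (1 + 2 * b) :=
        (norm_empCov_sub_condCov_le A y).trans (by gcongr; exact hmean.trans hδ1)
    _ ≤ η := by linarith

end FittedGaussian

section MomentConcentration

open Matrix
open scoped NNReal Matrix.Norms.Frobenius

section

variable {α κ : Type*} [MeasurableSpace α] {g : Measure α} [IsProbabilityMeasure g] {n : ℕ}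
  {u : κ → α → ℝ}

lemma integrable_sq_sampleMean_sub (hu : ∀ k, MemLp (u k) 2 g) (k : κ) :
    Integrable (fun y => (sampleMean (u k) y - ∫ x, u k x ∂g) ^ 2)
      (Measure.pi fun _ : Fin n => g) :=
  ((memLp_sampleMean (hu k)).sub (memLp_const _)).integrable_sq

variable [Fintype κ]

lemma integral_sum_sq_sampleMean_sub_le (hn : n ≠ 0) (hu : ∀ k, MemLp (u k) 2 g) :
    ∫ y, ∑ k, (sampleMean (u k) y - ∫ x, u k x ∂g) ^ 2 ∂(Measure.pi fun _ : Fin n => g) ≤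
      (∫ x, ∑ k, u k x ^ 2 ∂g) / n := by
  rw [integral_finsetSum _ fun k _ => integrable_sq_sampleMean_sub hu k,
    integral_finsetSum _ fun k _ => (hu k).integrable_sq, Finset.sum_div]
  refine Finset.sum_le_sum fun k _ => ?_
  rw [← integral_sampleMean hn ((hu k).integrable one_le_two),
    ← variance_eq_integral (memLp_sampleMean (hu k)).1.aemeasurable, variance_sampleMean (hu k)]
  exact div_le_div_of_nonneg_right (variance_le_expectation_sq (hu k).1) n.cast_nonneg

lemma measure_lt_sum_sq_sampleMean_sub_le {δ : ℝ} (hn : n ≠ 0) (hu : ∀ k, MemLp (u k) 2 g)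
    (hδ : 0 < δ) :
    (Measure.pi fun _ : Fin n => g) {y | δ < ∑ k, (sampleMean (u k) y - ∫ x, u k x ∂g) ^ 2} ≤
      ENNReal.ofReal ((∫ x, ∑ k, u k x ^ 2 ∂g) / (n * δ)) := by
  have hmarkov := mul_meas_ge_le_integral_of_nonneg
    (ae_of_all _ fun y => Finset.sum_nonneg fun k _ => sq_nonneg _)
    (integrable_finsetSum Finset.univ fun k _ => integrable_sq_sampleMean_sub (n := n) hu k) δ
  refine (measure_mono (t := {y | δ ≤ ∑ k, (sampleMean (u k) y - ∫ x, u k x ∂g) ^ 2})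
    fun y (hy : δ < _) => hy.le).trans ?_
  rw [← ofReal_measureReal]
  refine ENNReal.ofReal_le_ofReal ?_
  rw [← div_div, le_div_iff₀ hδ, mul_comm]
  exact hmarkov.trans (integral_sum_sq_sampleMean_sub_le hn hu)

end

variable {ι : Type*} [Fintype ι] {Q : Measure (EuclideanSpace ℝ ι)} {n : ℕ} {δ : ℝ}

lemma sum_sq_mul_eq_norm_pow_four (x : EuclideanSpace ℝ ι) :
    ∑ k : ι × ι, (x k.1 * x k.2) ^ 2 = ‖x‖ ^ 4 := by
  rw [Fintype.sum_prod_type, show ‖x‖ ^ 4 = ‖x‖ ^ 2 * ‖x‖ ^ 2 by ring,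
    EuclideanSpace.real_norm_sq_eq, Finset.sum_mul_sum]
  simp only [mul_pow]

lemma norm_pow_four_le (x : EuclideanSpace ℝ ι) :
    ‖x‖ ^ 4 ≤ Fintype.card ι * ∑ i, x i ^ 4 := by
  have hcs := sq_sum_le_card_mul_sum_sq (s := Finset.univ) (f := fun i => x i ^ 2)
  rw [← EuclideanSpace.real_norm_sq_eq] at hcs
  simpa only [← pow_mul, Nat.reduceMul, Finset.card_univ] using hcs

lemma measure_lt_norm_empSecondMoment_sub_le [IsProbabilityMeasure Q] (hQ : MemLp id 4 Q)
    (hn : n ≠ 0) (hδ : 0 < δ) :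
    (Measure.pi fun _ : Fin n => Q) {y | δ < ‖empSecondMoment y - secondMoment Q‖ ^ 2} ≤
      ENNReal.ofReal ((∫ x, ‖x‖ ^ 4 ∂Q) / (n * δ)) := by
  have hu (k : ι × ι) : MemLp (fun x : EuclideanSpace ℝ ι => x k.1 * x k.2) 2 Q :=
    haveI : ENNReal.HolderTriple 4 4 2 := ⟨by
      rw [← two_mul, show (4 : ENNReal) = 2 * 2 by norm_num, ENNReal.mul_inv (by simp) (by simp),
        ← mul_assoc, ENNReal.mul_inv_cancel (by simp) (by simp), one_mul]⟩
    (memLp_coord hQ k.2).mul (memLp_coord hQ k.1)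
  have hnorm (y : Fin n → EuclideanSpace ℝ ι) : ‖empSecondMoment y - secondMoment Q‖ ^ 2 =
      ∑ k : ι × ι, (sampleMean (fun x => x k.1 * x k.2) y - ∫ x, x k.1 * x k.2 ∂Q) ^ 2 := by
    rw [frobenius_norm_sq, Fintype.sum_prod_type]
    rfl
  simp only [hnorm]
  simpa only [sum_sq_mul_eq_norm_pow_four] using measure_lt_sum_sq_sampleMean_sub_le hn hu hδ

lemma measure_lt_norm_empMean_sub_le {d : ℕ+} {Q : Measure (Euc d)} [IsProbabilityMeasure Q]
    (hQ : MemLp id 2 Q) (hn : n ≠ 0) (hδ : 0 < δ) :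
    (Measure.pi fun _ : Fin n => Q) {y | δ < ‖empMean y - mean Q‖ ^ 2} ≤
      ENNReal.ofReal ((∫ x, ‖x‖ ^ 2 ∂Q) / (n * δ)) := by
  simp only [EuclideanSpace.real_norm_sq_eq, PiLp.sub_apply, empMean_apply,
    mean_apply (hQ.integrable one_le_two)]
  exact measure_lt_sum_sq_sampleMean_sub_le hn (memLp_coord hQ) hδ

lemma measurePreserving_eval_stdGaussian (i : ι) :
    MeasurePreserving (fun x : EuclideanSpace ℝ ι => x i) (stdGaussian (EuclideanSpace ℝ ι))
      (gaussianReal 0 1) := by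
  classical
  simpa [multivariateGaussian_zero_one] using
    measurePreserving_eval_multivariateGaussian (μ := (0 : EuclideanSpace ℝ ι)) PosSemidef.one
      (i := i)

lemma integrable_pow_stdGaussian (k : ℕ) (i : ι) :
    Integrable (fun x => x i ^ k) (stdGaussian (EuclideanSpace ℝ ι)) := by
  have h := (memLp_coord (IsGaussian.memLp_id (stdGaussian (EuclideanSpace ℝ ι)) k (by simp)) i)
  rcases eq_or_ne k 0 with rfl | hk
  · simp
  · exact (integrable_norm_iff (by fun_prop)).1
      ((h.integrable_norm_pow hk).congr (ae_of_all _ fun x => (norm_pow _ _).symm))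

lemma integral_sum_pow_stdGaussian (k : ℕ) :
    ∫ x, ∑ i, x i ^ k ∂stdGaussian (EuclideanSpace ℝ ι) =
      Fintype.card ι * ∫ x, x ^ k ∂gaussianReal 0 1 := by
  have hcoord (i : ι) : ∫ x, x i ^ k ∂stdGaussian (EuclideanSpace ℝ ι) =
      ∫ x, x ^ k ∂gaussianReal 0 1 := by
    have hpres := measurePreserving_eval_stdGaussian i
    rw [← hpres.map_eq, integral_map hpres.measurable.aemeasurable (by fun_prop)]
  rw [integral_finsetSum _ fun i _ => integrable_pow_stdGaussian k i]
  simp only [hcoord, Finset.sum_const, Finset.card_univ, nsmul_eq_mul]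

lemma integral_norm_sq_stdGaussian :
    ∫ x, ‖x‖ ^ 2 ∂stdGaussian (EuclideanSpace ℝ ι) =
      Fintype.card ι * ∫ x, x ^ 2 ∂gaussianReal 0 1 := by
  simp only [EuclideanSpace.real_norm_sq_eq, integral_sum_pow_stdGaussian]

lemma integral_norm_pow_four_stdGaussian_le :
    ∫ x, ‖x‖ ^ 4 ∂stdGaussian (EuclideanSpace ℝ ι) ≤
      Fintype.card ι ^ 2 * ∫ x, x ^ 4 ∂gaussianReal 0 1 := by
  calc ∫ x, ‖x‖ ^ 4 ∂stdGaussian (EuclideanSpace ℝ ι)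
      ≤ ∫ x, Fintype.card ι * ∑ i, x i ^ 4 ∂stdGaussian (EuclideanSpace ℝ ι) :=
        integral_mono_of_nonneg (ae_of_all _ fun x => by positivity)
          ((integrable_finsetSum _ fun i _ => integrable_pow_stdGaussian 4 i).const_mul _)
          (ae_of_all _ norm_pow_four_le)
    _ = _ := by rw [integral_const_mul, integral_sum_pow_stdGaussian, ← mul_assoc, sq]

lemma exists_measure_pi_cond_stdN_le :
    ∃ C ≥ 0, ∀ (d : ℕ+) (A : Set (Euc d)), stdN d A ≠ 0 → ∀ n : ℕ, n ≠ 0 → ∀ δ > 0,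
      (Measure.pi fun _ : Fin n => cond (stdN d) A)
          {y | ¬(‖empSecondMoment y - secondMoment (cond (stdN d) A)‖ ^ 2 ≤ δ ∧
            ‖empMean y - condMean A‖ ^ 2 ≤ δ)} ≤
        ENNReal.ofReal (C * d ^ 2 / ((stdN d).real A * n * δ)) := by
  set m₂ := ∫ x : ℝ, x ^ 2 ∂gaussianReal 0 1
  set m₄ := ∫ x : ℝ, x ^ 4 ∂gaussianReal 0 1
  refine ⟨m₄ + m₂, by positivity, fun d A hA n hn δ hδ => ?_⟩
  have := cond_isProbabilityMeasure hA
  have hmemLp (p : ℝ≥0) : MemLp id (p : ENNReal) (stdN d) := IsGaussian.memLp_id _ _ (by simp)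
  have hd : (1 : ℝ) ≤ d := by exact_mod_cast d.pos
  have hfourth : ∫ x, ‖x‖ ^ 4 ∂cond (stdN d) A ≤ d ^ 2 * m₄ / (stdN d).real A := by
    refine (integral_cond_le ((hmemLp 4).integrable_norm_pow (by norm_num))
      fun x => by positivity).trans (div_le_div_of_nonneg_right ?_ measureReal_nonneg)
    exact integral_norm_pow_four_stdGaussian_le.trans_eq (by rw [Fintype.card_fin])
  have hsecond : ∫ x, ‖x‖ ^ 2 ∂cond (stdN d) A ≤ d ^ 2 * m₂ / (stdN d).real A := by
    refine (integral_cond_le ((hmemLp 2).integrable_norm_pow (by norm_num))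
      fun x => by positivity).trans (div_le_div_of_nonneg_right ?_ measureReal_nonneg)
    refine integral_norm_sq_stdGaussian.trans_le ?_
    rw [Fintype.card_fin]
    exact mul_le_mul_of_nonneg_right (le_self_pow₀ hd two_ne_zero)
      (integral_nonneg fun x => sq_nonneg x)
  simp only [not_and_or, not_le, Set.ofPred_or]
  refine (measure_union_le _ _).trans ((add_le_add
    (measure_lt_norm_empSecondMoment_sub_le (memLp_cond hA (hmemLp 4)) hn hδ)
    (measure_lt_norm_empMean_sub_le (memLp_cond hA (hmemLp 2)) hn hδ)).trans ?_)
  rw [← ENNReal.ofReal_add (by positivity) (by positivity)]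
  refine ENNReal.ofReal_le_ofReal ?_
  calc _ ≤ d ^ 2 * m₄ / (stdN d).real A / (n * δ) + d ^ 2 * m₂ / (stdN d).real A / (n * δ) := by
        gcongr
    _ = (m₄ + m₂) * d ^ 2 / ((stdN d).real A * n * δ) := by ring

end MomentConcentration

section Measurability

variable {β : Type*} [MeasurableSpace β]

lemma measurable_pi_measure {α : Type*} [MeasurableSpace α] {η : β → Measure α}
    [∀ b, IsProbabilityMeasure (η b)] (hη : Measurable η) (n : ℕ) :
    Measurable fun b => Measure.pi fun _ : Fin n => η b := by
  refine .measure_of_isPiSystem_of_isProbabilityMeasure generateFrom_pi.symm isPiSystem_pi ?_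
  rintro _ ⟨s, hs, rfl⟩
  simp only [Measure.pi_pi]
  exact Finset.measurable_prod _ fun i _ =>
    (Measure.measurable_coe (hs i (Set.mem_univ i))).comp hη

section

variable {d : ℕ+} {f : Measure (Euc d)} [IsFiniteMeasure f] {η : β → Measure (Euc d)}
  [∀ b, IsProbabilityMeasure (η b)] {n : ℕ}

lemma measurable_integral_pi_likelihoodRatio (hη : Measurable η)
    {Φ : (Fin n → ℝ) × (Fin n → Euc d) → ℝ} (hΦ : Measurable Φ) :
    Measurable fun b => ∫ y, Φ (fun i => likelihoodRatio f (η b) (y i), y)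
      ∂(Measure.pi fun _ : Fin n => η b) := by
  let κ : Kernel β (Euc d) := ⟨η, hη⟩
  have : IsMarkovKernel κ := ⟨fun b => inferInstanceAs (IsProbabilityMeasure (η b))⟩
  let κn : Kernel β (Fin n → Euc d) := ⟨_, measurable_pi_measure hη n⟩
  have : IsMarkovKernel κn :=
    ⟨fun b => inferInstanceAs (IsProbabilityMeasure (Measure.pi fun _ : Fin n => η b))⟩
  have hversion (b : β) :
      ∫ y, Φ (fun i => likelihoodRatio f (η b) (y i), y) ∂(Measure.pi fun _ : Fin n => η b) =
        ∫ y, Φ (fun i => (Kernel.rnDeriv (Kernel.const β f) κ b (y i)).toReal, y) ∂(κn b) := by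
    have hae : ∀ᵐ y ∂(Measure.pi fun _ : Fin n => η b), ∀ i,
        Kernel.rnDeriv (Kernel.const β f) κ b (y i) = f.rnDeriv (η b) (y i) :=
      ae_all_iff.2 fun i => (Measure.quasiMeasurePreserving_eval (μ := fun _ : Fin n => η b) i).ae
        (Kernel.rnDeriv_eq_rnDeriv_measure (κ := Kernel.const β f) (η := κ) (a := b))
    refine integral_congr_ae ?_
    filter_upwards [hae] with y hy
    simp only [likelihoodRatio, hy]
  simp only [hversion]
  refine (StronglyMeasurable.integral_kernel_prod_right (κ := κn)
    (f := fun b y => Φ (fun i => (Kernel.rnDeriv (Kernel.const β f) κ b (y i)).toReal, y))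
    (hΦ.comp (Measurable.prodMk (measurable_pi_lambda _ fun i => ?_)
      measurable_snd)).stronglyMeasurable).measurable
  exact ((Kernel.measurable_rnDeriv _ _).comp
    (measurable_fst.prodMk ((measurable_pi_apply i).comp measurable_snd))).ennreal_toReal

lemma measurable_weightRatio (hη : Measurable η) (n : ℕ) :
    Measurable fun b => weightRatio f (η b) n :=
  measurable_integral_pi_likelihoodRatio hη (Φ := fun q => (⨆ i, q.1 i) / ∑ i, q.1 i) <|
    (Measurable.iSup fun i => by fun_prop).div (by fun_prop)

lemma measurable_isError (hη : Measurable η) {A : Set (Euc d)} (hA : MeasurableSet A) (n : ℕ) :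
    Measurable fun b => isError f (η b) A n :=
  measurable_integral_pi_likelihoodRatio hη
    (Φ := fun q => |1 / (n : ℝ) * (∑ i, q.1 i * A.indicator (fun _ => 1) (q.2 i)) / f.real A - 1|)
    ((((Finset.measurable_sum _ fun i _ => Measurable.mul (by fun_prop)
      ((measurable_const.indicator hA).comp (by fun_prop))).const_mul _).div_const _).sub_const
        1).abs

end

lemma measurable_measure_map {γ δ : Type*} [MeasurableSpace γ] [MeasurableSpace δ]
    {ν : Measure γ} [SFinite ν] {φ : β × γ → δ} (hφ : Measurable φ) :
    Measurable fun b => ν.map fun z => φ (b, z) := by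
  refine Measure.measurable_of_measurable_coe _ fun s hs => ?_
  have hmap (b : β) : (ν.map fun z => φ (b, z)) s = ν (Prod.mk b ⁻¹' (φ ⁻¹' s)) :=
    Measure.map_apply (hφ.comp measurable_prodMk_left) hs
  simp only [hmap]
  exact measurable_measure_prodMk_left (hφ hs)

section

variable {d : ℕ+} {n : ℕ}

lemma continuous_empMean : Continuous fun y : Fin n → Euc d => empMean y := by
  unfold empMean
  fun_prop

lemma continuous_empCov : Continuous fun y : Fin n → Euc d => empCov y := by
  refine continuous_matrix fun i j => ?_
  simp only [empCov, Matrix.of_apply, empMean_apply, sampleMean]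
  fun_prop

open scoped MatrixOrder Matrix.Norms.L2Operator in
lemma continuous_sqrt_empCov : Continuous fun y : Fin n → Euc d => CFC.sqrt (empCov y) :=
  CFC.continuousOn_sqrt.comp_continuous continuous_empCov fun y => (posSemidef_empCov y).nonneg

open scoped MatrixOrder in
lemma measurable_empGauss : Measurable fun y : Fin n → Euc d => empGauss y := by
  refine measurable_measure_map (φ := fun q : (Fin n → Euc d) × Euc d =>
    empMean q.1 + Matrix.toEuclideanCLM (𝕜 := ℝ) (CFC.sqrt (empCov q.1)) q.2)
    (Continuous.measurable ?_)
  exact (continuous_empMean.comp continuous_fst).add <| (PiLp.continuous_toLp 2 _).comp <|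
    (continuous_sqrt_empCov.comp continuous_fst).matrix_mulVec
      ((PiLp.continuous_ofLp 2 _).comp continuous_snd)

end

end Measurability

section Efficiency

open InformationTheory
open scoped NNReal

variable {Ω : ℕ+ → Type*} [∀ d, MeasurableSpace (Ω d)] {P : ∀ d, Measure (Ω d)}
  [∀ d, IsProbabilityMeasure (P d)]

lemma tendstoZeroInLaw_of_tendsto_measure {X : ∀ d, Ω d → ℝ} (hX : ∀ d, AEMeasurable (X d) (P d))
    (h : ∀ ε > 0, Tendsto (fun d => P d {ω | ε ≤ |X d ω|}) atTop (𝓝 0)) :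
    TendstoZeroInLaw P X := by
  refine ⟨hX, by fun_prop, tendsto_of_forall_isOpen_le_liminf' fun G hG => ?_⟩
  change (Measure.dirac ()).map (fun _ => (0 : ℝ)) G ≤ liminf (fun d => (P d).map (X d) G) atTop
  rw [Measure.map_const, measure_univ, one_smul, Measure.dirac_apply' _ hG.measurableSet]
  by_cases hG0 : (0 : ℝ) ∈ G
  swap
  · simp [hG0]
  obtain ⟨r, hr, hball⟩ := Metric.isOpen_iff.1 hG 0 hG0
  have hlim : Tendsto (fun d => 1 - P d {ω | r ≤ |X d ω|}) atTop (𝓝 1) := by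
    simpa using ENNReal.Tendsto.sub tendsto_const_nhds (h r hr) (.inl ENNReal.one_ne_top)
  rw [Set.indicator_of_mem hG0, Pi.one_apply, ← hlim.liminf_eq]
  refine liminf_le_liminf (Eventually.of_forall fun d => ?_)
  have hcover : Set.univ ⊆ X d ⁻¹' G ∪ {ω | r ≤ |X d ω|} := fun ω _ =>
    (lt_or_ge |X d ω| r).imp (fun hω => hball (by simpa using hω)) id
  rw [Measure.map_apply_of_aemeasurable (hX d) hG.measurableSet, tsub_le_iff_right,
    ← measure_univ (μ := P d)]
  exact (measure_mono hcover).trans (measure_union_le _ _)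

lemma tendstoZeroInLaw_of_eventually_le {X : ∀ d, Ω d → ℝ} {G : ∀ d, Set (Ω d)}
    (hX : ∀ d, AEMeasurable (X d) (P d)) (hX0 : ∀ d ω, 0 ≤ X d ω)
    (hG : Tendsto (fun d => P d (G d)ᶜ) atTop (𝓝 0))
    (hXG : ∀ ε > 0, ∀ᶠ d in atTop, ∀ ω ∈ G d, X d ω ≤ ε) : TendstoZeroInLaw P X := by
  refine tendstoZeroInLaw_of_tendsto_measure hX fun ε hε => ?_
  refine tendsto_of_tendsto_of_tendsto_of_le_of_le' tendsto_const_nhds hG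
    (.of_forall fun _ => zero_le) ?_
  filter_upwards [hXG (ε / 2) (half_pos hε)] with d hd
  refine measure_mono fun ω hω hωG => ?_
  rw [Set.mem_ofPred_eq, abs_of_nonneg (hX0 d ω)] at hω
  linarith [hd ω hωG]

variable {A : ∀ d, Set (Euc d)} {p : ℝ}

lemma efficientInHighDim_of_klDiv_le {f : ∀ d, Measure (Euc d)} [∀ d, IsProbabilityMeasure (f d)]
    (hA : ∀ d, MeasurableSet (A d)) (hp : 0 < p) (hpA : ∀ d, p ≤ (f d).real (A d))
    {g : ∀ d, Ω d → Measure (Euc d)} [∀ d ω, IsProbabilityMeasure (g d ω)]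
    (hg : ∀ d, AEMeasurable (g d) (P d)) {K : ℝ≥0}
    (hK : Tendsto (fun d => P d {ω | klDiv (f d) (g d ω) ≤ K}ᶜ) atTop (𝓝 0)) :
    EfficientInHighDim P f A g := by
  have hgprob (d : ℕ+) : AEMeasurable (fun ω => (⟨g d ω, inferInstance⟩ :
      ProbabilityMeasure (Euc d))) (P d) := (hg d).subtype_mk
  refine fun n hn =>
    ⟨tendstoZeroInLaw_of_eventually_le (fun d => ?_) (fun _ _ => weightRatio_nonneg ..) hK
      fun ε hε => ?_,
    tendstoZeroInLaw_of_eventually_le (fun d => ?_) (fun _ _ => isError_nonneg ..) hK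
      fun ε hε => ?_⟩
  · exact (measurable_weightRatio (η := ProbabilityMeasure.toMeasure) measurable_subtype_coe
      (n d)).comp_aemeasurable (hgprob d)
  · obtain ⟨N, hN⟩ := exists_forall_weightRatio_le K hε
    filter_upwards [hn.eventually_ge_atTop N] with d hd ω hω
    exact hN d _ _ hω _ hd
  · exact (measurable_isError (η := ProbabilityMeasure.toMeasure) measurable_subtype_coe (hA d)
      (n d)).comp_aemeasurable (hgprob d)
  · obtain ⟨N, hN⟩ := exists_forall_isError_le K hp hε
    filter_upwards [hn.eventually_ge_atTop N] with d hd ω hω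
    exact hN d _ _ _ hω (hA d) (hpA d) _ hd

theorem detEfficientInHighDim_gaussA (hA : ∀ d, MeasurableSet (A d)) (hp : 0 < p)
    (hpA : ∀ d, p ≤ (stdN d).real (A d)) :
    DetEfficientInHighDim stdN A fun d => gaussA (A d) := by
  obtain ⟨K, hK⟩ := exists_klDiv_gaussA_le hp
  have (d : ℕ+) : IsProbabilityMeasure (gaussA (A d)) :=
    inferInstanceAs (IsProbabilityMeasure (multivariateGaussian _ _))
  refine efficientInHighDim_of_klDiv_le hA hp hpA (fun _ => aemeasurable_const) (K := K) ?_
  simp [fun d => hK d (A d) (hpA d)]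

lemma tendsto_measure_compl_klDiv_empGauss_le (hp : 0 < p) (hpA : ∀ d, p ≤ (stdN d).real (A d))
    {n : ℕ+ → ℕ} (hn : Tendsto (fun d => (n d : ℝ) / (d : ℝ) ^ 2) atTop atTop) :
    ∃ K : ℝ≥0, Tendsto (fun d => (Measure.pi fun _ : Fin (n d) => cond (stdN d) (A d))
      {y | klDiv (stdN d) (empGauss y) ≤ K}ᶜ) atTop (𝓝 0) := by
  obtain ⟨δ, hδ, K, hK⟩ := exists_klDiv_empGauss_le hp
  obtain ⟨C, hC, hdev⟩ := exists_measure_pi_cond_stdN_le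
  have hlim : Tendsto (fun d => ENNReal.ofReal (C / (p * δ) * ((n d : ℝ) / (d : ℝ) ^ 2)⁻¹))
      atTop (𝓝 0) := by
    simpa using ENNReal.tendsto_ofReal (hn.inv_tendsto_atTop.const_mul (C / (p * δ)))
  refine ⟨K, tendsto_of_tendsto_of_tendsto_of_le_of_le' tendsto_const_nhds hlim
    (.of_forall fun _ => zero_le) ?_⟩
  filter_upwards [hn.eventually_gt_atTop 0] with d hd
  have hn0 : n d ≠ 0 := by
    rintro h
    simp [h] at hd
  have hA0 : stdN d (A d) ≠ 0 := (measureReal_ne_zero_iff ..).1 (hp.trans_le (hpA d)).ne'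
  refine (measure_mono fun y => mt (and_imp.2 (hK d (A d) (hpA d) _ y))).trans
    ((hdev d (A d) hA0 (n d) hn0 δ hδ).trans (ENNReal.ofReal_le_ofReal ?_))
  calc C * d ^ 2 / ((stdN d).real (A d) * n d * δ) ≤ C * d ^ 2 / (p * n d * δ) := by
        gcongr
        exact hpA d
    _ = C / (p * δ) * ((n d : ℝ) / (d : ℝ) ^ 2)⁻¹ := by
        field_simp

theorem efficientInHighDim_empGauss (hA : ∀ d, MeasurableSet (A d)) (hp : 0 < p)
    (hpA : ∀ d, p ≤ (stdN d).real (A d)) {n : ℕ+ → ℕ} {Y : ∀ d, Fin (n d) → Ω d → Euc d}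
    (hn : Tendsto (fun d => (n d : ℝ) / (d : ℝ) ^ 2) atTop atTop)
    (hindep : ∀ d, iIndepFun (Y d) (P d))
    (hlaw : ∀ d k, HasLaw (Y d k) (cond (stdN d) (A d)) (P d)) :
    EfficientInHighDim P stdN A fun d ω => empGauss fun k => Y d k ω := by
  obtain ⟨K, hK⟩ := tendsto_measure_compl_klDiv_empGauss_le hp hpA hn
  have hY (d : ℕ+) : HasLaw (fun ω k => Y d k ω) (Measure.pi fun _ => cond (stdN d) (A d)) (P d) :=
    (hindep d).hasLaw_pi (hlaw d)
  have (d : ℕ+) (ω : Ω d) : IsProbabilityMeasure (empGauss fun k => Y d k ω) :=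
    inferInstanceAs (IsProbabilityMeasure (multivariateGaussian _ _))
  refine efficientInHighDim_of_klDiv_le hA hp hpA
    (fun d => measurable_empGauss.comp_aemeasurable (hY d).aemeasurable) (K := K) ?_
  refine tendsto_of_tendsto_of_tendsto_of_le_of_le tendsto_const_nhds hK (fun _ => zero_le)
    fun d => ?_
  exact (Measure.le_map_apply (hY d).aemeasurable _).trans_eq (by rw [(hY d).map_eq])

end Efficiency

end HighDimIS

end

theorem corollary1
    (A : ∀ d : ℕ+, Set (HighDimIS.Euc d)) (hA : ∀ d, MeasurableSet (A d))
    (hp : 0 < ⨅ d : ℕ+, (HighDimIS.stdN d).real (A d)) :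
    HighDimIS.DetEfficientInHighDim HighDimIS.stdN A (fun d => HighDimIS.gaussA (A d)) ∧
    ∀ (Ω : ℕ+ → Type*) [∀ d, MeasurableSpace (Ω d)]
      (P : ∀ d, Measure (Ω d)) [∀ d, IsProbabilityMeasure (P d)]
      (ng : ℕ+ → ℕ) (Y : ∀ d, Fin (ng d) → Ω d → HighDimIS.Euc d),
      Tendsto (fun d : ℕ+ => (ng d : ℝ) / ((d : ℕ) : ℝ) ^ 2) atTop atTop →
      (∀ d, iIndepFun (Y d) (P d)) →
      (∀ d k, HasLaw (Y d k) (cond (HighDimIS.stdN d) (A d)) (P d)) →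
      HighDimIS.EfficientInHighDim P HighDimIS.stdN A
        (fun d ω => HighDimIS.empGauss (fun k => Y d k ω)) := by
  have hpA (d : ℕ+) :
      ⨅ d : ℕ+, (HighDimIS.stdN d).real (A d) ≤ (HighDimIS.stdN d).real (A d) :=
    ciInf_le ⟨0, Set.forall_mem_range.2 fun _ => measureReal_nonneg⟩ d
  exact ⟨HighDimIS.detEfficientInHighDim_gaussA hA hp hpA, fun _ _ _ _ _ _ hng hindep hlaw =>
    HighDimIS.efficientInHighDim_empGauss hA hp hpA hng hindep hlaw⟩
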